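/- Let $n\ge 1$ and let $\mathbb H_n=\mathbb C^n\times\mathbb R$ be the Heisenberg group with product $[z,t]\cdot[z',t']=[z+z',\,t+t'+2\,\mathrm{Im}\,(z\cdot\bar z')]$, identity $e$, inverse $i[z,t]=[z,t]^{-1}=[-z,-t]$, gauge $N([z,t])=(|z|^4+t^2)^{1/4}$ and Lebesgue measure. With $Z_j=\partial_{z_j}+i\bar z_j\partial_t$ and $\bar Z_j=\partial_{\bar z_j}-iz_j\partial_t$ put $L_0=-\tfrac12\sum_{j=1}^n(\bar Z_jZ_j+Z_j\bar Z_j)$. Let $g_e([z,t])=a_0(|z|^4+t^2)^{-n/2}$ with $a_0=2^{n-2}\Gamma(n/2)^2/\pi^{n+1}$, and $g_\eta(\xi)=g_e(\xi^{-1}\eta)$. For a function $f$ let $\bar f([z,t])=\frac1{2\pi}\int_0^{2\pi}f([e^{i\theta}z,t])\,d\theta$; call $f$ circular if $f([e^{i\theta}z,t])=f([z,t])$ for all $\theta,z,t$. For $\eta=[\varsigma,\tau]$ let $O_\eta=\{[e^{i\theta}\varsigma,\tau]:\theta\in\mathbb R\}$. For $R>0$ put $$h_R([z,t])=\Big[\frac{-R^2z}{|z|^2-it},\frac{-R^4t}{|z|^4+t^2}\Big],\qquad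 K_Rf=R^{2n}N^{-2n}\,(f\circ h_R),\qquad K=K_1 .$$ Let $0<R<1$, $D=\{\xi\in\mathbb H_n: R<N(\xi)<1\}$ and $\eta\in D$. Define functions of $\xi$ by $$M_1=\bar g_\eta,\quad H_1=K(\bar g_\eta)\circ i,\quad U_1=K_R(\bar g_\eta)\circ i,\quad V_1=K\big(K_R(\bar g_\eta)\circ i\big)\circ i,$$ $$M_{k+1}=K_R\big(K(M_k)\circ i\big)\circ i,\qquad U_{k+1}=K_R\big(K(U_k)\circ i\big)\circ i,$$ $$H_{k+1}=K\big(K_R(H_k)\circ i\big)\circ i,\qquad V_{k+1}=K\big(K_R(V_k)\circ i\big)\circ i,$$ and $$G(\eta,\xi)=\sum_{k=1}^\infty\big[M_k(\xi)-H_k(\xi)\big]+\sum_{k=1}^\infty\big[V_k(\xi)-U_k(\xi)\big].$$ Theorem 2.1. Both series converge absolutely and locally uniformly on $D\setminus O_\eta$ (as do the series of absolute values of their terms), and $G(\eta,\cdot)$ is $C^\infty$ on $D\setminus O_\eta$. Moreover: (i) $L_0G(\eta,\cdot)=\delta_\eta$ in $D$ for circular data: $G(\eta,\cdot)$ is locally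 integrable on $D$, and $$\int_D G(\eta,\xi)\,L_0\varphi(\xi)\,d\xi=\varphi(\eta)\quad\text{for every circular }\varphi\in C_c^\infty(D);$$ for an arbitrary $\varphi\in C_c^\infty(D)$ the integral equals $\bar\varphi(\eta)$. (ii) $G(\eta,\xi)\to0$ as $N(\xi)\to1$ and as $N(\xi)\to R$, $\xi\in D$. -/

import Mathlib

open scoped ContDiff

noncomputable section

namespace Heisenberg

/-- The underlying manifold `ℂⁿ × ℝ` of the Heisenberg group; a point `[z, t]` is `(z, t)`.
Its volume is Lebesgue measure, which is the Haar measure of the group. -/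
abbrev Heis (n : ℕ) : Type := (Fin n → ℂ) × ℝ

variable {n : ℕ}

/-- The Hermitian product `z · w̄`. -/
def dotConj (z w : Fin n → ℂ) : ℂ := ∑ j, z j * (starRingEnd ℂ) (w j)

/-- The squared Euclidean norm `|z|²`. -/
def normSq (z : Fin n → ℂ) : ℝ := ∑ j, ‖z j‖ ^ 2

/-- The group law `[z,t]·[z',t'] = [z + z', t + t' + 2 Im (z · z̄')]`. -/
def mul (ξ η : Heis n) : Heis n :=
  (ξ.1 + η.1, ξ.2 + η.2 + 2 * (dotConj ξ.1 η.1).im)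

/-- The group inverse `[z,t]⁻¹ = [-z,-t]`. -/
def inv (ξ : Heis n) : Heis n := (-ξ.1, -ξ.2)

theorem mul_assoc (ξ η ζ : Heis n) : mul (mul ξ η) ζ = mul ξ (mul η ζ) := by
  simp only [mul, dotConj, Prod.mk.injEq, Pi.add_apply, add_mul, mul_add, map_add,
    Finset.sum_add_distrib, Complex.add_im]
  exact ⟨add_assoc _ _ _, by ring⟩

theorem inv_mul_self (ξ : Heis n) : mul (inv ξ) ξ = 0 := by
  have h : (dotConj (-ξ.1) ξ.1).im = 0 := by
    simp [dotConj, Complex.mul_conj]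
  simp [mul, inv, h]

/-- The gauge `N(z,t) = (|z|⁴ + t²)^{1/4}`. -/
def gauge (ξ : Heis n) : ℝ := (normSq ξ.1 ^ 2 + ξ.2 ^ 2) ^ (1 / 4 : ℝ)

/-- The annulus `{ξ : R < N(ξ) < 1}`. -/
def annulus (n : ℕ) (R : ℝ) : Set (Heis n) := {ξ | R < gauge ξ ∧ gauge ξ < 1}

/-! ### The vector fields and the operator `L₀` -/

/-- `∂_{z_j} = ½ (∂_{x_j} - i ∂_{y_j})`. -/
def dz (j : Fin n) (f : Heis n → ℂ) (ξ : Heis n) : ℂ :=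
  (1 / 2) * (fderiv ℝ f ξ (Pi.single j 1, 0)
    - Complex.I * fderiv ℝ f ξ (Pi.single j Complex.I, 0))

/-- `∂_{z̄_j} = ½ (∂_{x_j} + i ∂_{y_j})`. -/
def dzbar (j : Fin n) (f : Heis n → ℂ) (ξ : Heis n) : ℂ :=
  (1 / 2) * (fderiv ℝ f ξ (Pi.single j 1, 0)
    + Complex.I * fderiv ℝ f ξ (Pi.single j Complex.I, 0))

/-- `T = ∂_t`. -/
def T (f : Heis n → ℂ) (ξ : Heis n) : ℂ := fderiv ℝ f ξ (0, 1)

/-- `Z_j = ∂_{z_j} + i z̄_j ∂_t`. -/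
def Z (j : Fin n) (f : Heis n → ℂ) (ξ : Heis n) : ℂ :=
  dz j f ξ + Complex.I * (starRingEnd ℂ) (ξ.1 j) * T f ξ

/-- `Z̄_j = ∂_{z̄_j} - i z_j ∂_t`. -/
def Zbar (j : Fin n) (f : Heis n → ℂ) (ξ : Heis n) : ℂ :=
  dzbar j f ξ - Complex.I * ξ.1 j * T f ξ

/-- The sublaplacian `Δ₀ = 2 ∑ⱼ (Z̄ⱼ Zⱼ + Zⱼ Z̄ⱼ)`. -/
def subLaplacian (f : Heis n → ℂ) (ξ : Heis n) : ℂ :=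
  2 * ∑ j, (Zbar j (Z j f) ξ + Z j (Zbar j f) ξ)

/-- `L₀ = -¼ Δ₀`. -/
def L0 (f : Heis n → ℂ) (ξ : Heis n) : ℂ := -(1 / 4) * subLaplacian f ξ

/-! ### The fundamental solution and circular averages -/

/-- The constant `a₀ = 2^{n-2} Γ(n/2)² / π^{n+1}`. -/
def a0 (n : ℕ) : ℝ :=
  2 ^ ((n : ℝ) - 2) * Real.Gamma ((n : ℝ) / 2) ^ 2 / Real.pi ^ (n + 1)

/-- The fundamental solution of `L₀` with pole at the identity. -/
def fundSol (ξ : Heis n) : ℝ :=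
  a0 n * (normSq ξ.1 ^ 2 + ξ.2 ^ 2) ^ (-((n : ℝ) / 2))

/-- The fundamental solution of `L₀` with pole at `η`: `g_η(ξ) = g_e(ξ⁻¹ η)`. -/
def fundSolAt (η ξ : Heis n) : ℝ := fundSol (mul (inv ξ) η)

/-- The rotation `[z,t] ↦ [e^{iθ} z, t]`. -/
def rot (θ : ℝ) (ξ : Heis n) : Heis n := (Complex.exp (θ * Complex.I) • ξ.1, ξ.2)

/-- A function is circular if it is invariant under all rotations `[z,t] ↦ [e^{iθ} z, t]`. -/
def IsCircular {E : Type*} (f : Heis n → E) : Prop := ∀ (θ : ℝ) (ξ : Heis n), f (rot θ ξ) = f ξ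

/-- The circle `{[e^{iθ} ς, τ] : θ ∈ ℝ}` through `η = [ς, τ]`. -/
def orbit (η : Heis n) : Set (Heis n) := Set.range fun θ : ℝ => rot θ η

/-- The circular average `f̄([z,t]) = (1/2π) ∫₀^{2π} f([e^{iθ} z, t]) dθ`. -/
def circAvg {E : Type*} [NormedAddCommGroup E] [NormedSpace ℝ E]
    (f : Heis n → E) (ξ : Heis n) : E :=
  (2 * Real.pi)⁻¹ • ∫ θ in (0 : ℝ)..(2 * Real.pi), f (rot θ ξ)

/-! ### The Kelvin transforms -/

/-- The inversion `h([z,t]) = [-z/(|z|² - it), -t/(|z|⁴ + t²)]`. -/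
def inversion (ξ : Heis n) : Heis n :=
  (fun j => -ξ.1 j / ((normSq ξ.1 : ℂ) - Complex.I * (ξ.2 : ℂ)),
    -ξ.2 / (normSq ξ.1 ^ 2 + ξ.2 ^ 2))

/-- The inversion in the gauge ball of radius `R`,
`h_R([z,t]) = [-R² z/(|z|² - it), -R⁴ t/(|z|⁴ + t²)]`. -/
def inversionR (R : ℝ) (ξ : Heis n) : Heis n :=
  (fun j => -(R : ℂ) ^ 2 * ξ.1 j / ((normSq ξ.1 : ℂ) - Complex.I * (ξ.2 : ℂ)),
    -R ^ 4 * ξ.2 / (normSq ξ.1 ^ 2 + ξ.2 ^ 2))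

/-- The Kelvin transform `K f = N^{-2n} · f ∘ h`. -/
def kelvin (f : Heis n → ℝ) (ξ : Heis n) : ℝ :=
  (gauge ξ ^ (2 * n))⁻¹ * f (inversion ξ)

/-- The Kelvin `R`-transform `K_R f = R^{2n} · N^{-2n} · f ∘ h_R`. The weight is `N^{-2n}`, without
the constant `a₀`, so that `K_R f (ξ⁻¹) = f ξ` for circular `f` when `N(ξ) = R`. -/
def kelvinR (R : ℝ) (f : Heis n → ℝ) (ξ : Heis n) : ℝ :=
  R ^ (2 * n) * (gauge ξ ^ (2 * n))⁻¹ * f (inversionR R ξ)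

/-! ### The four families of iterated transforms

The index is shifted by one: `M R η k` is the function `M_{k+1}(η, ·)`, and likewise for the others. -/

/-- `H₁ = K(ḡ_η) ∘ i`, `H_{k+1} = K(K_R(H_k) ∘ i) ∘ i`. -/
def H (R : ℝ) (η : Heis n) : ℕ → Heis n → ℝ
  | 0 => kelvin (circAvg (fundSolAt η)) ∘ inv
  | k + 1 => kelvin (kelvinR R (H R η k) ∘ inv) ∘ inv

/-- `M₁ = ḡ_η`, `M_{k+1} = K_R(K(M_k) ∘ i) ∘ i`. -/
def M (R : ℝ) (η : Heis n) : ℕ → Heis n → ℝ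
  | 0 => circAvg (fundSolAt η)
  | k + 1 => kelvinR R (kelvin (M R η k) ∘ inv) ∘ inv

/-- `U₁ = K_R(ḡ_η) ∘ i`, `U_{k+1} = K_R(K(U_k) ∘ i) ∘ i`. -/
def U (R : ℝ) (η : Heis n) : ℕ → Heis n → ℝ
  | 0 => kelvinR R (circAvg (fundSolAt η)) ∘ inv
  | k + 1 => kelvinR R (kelvin (U R η k) ∘ inv) ∘ inv

/-- `V₁ = K(K_R(ḡ_η) ∘ i) ∘ i`, `V_{k+1} = K(K_R(V_k) ∘ i) ∘ i`. -/
def V (R : ℝ) (η : Heis n) : ℕ → Heis n → ℝ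
  | 0 => kelvin (kelvinR R (circAvg (fundSolAt η)) ∘ inv) ∘ inv
  | k + 1 => kelvin (kelvinR R (V R η k) ∘ inv) ∘ inv

/-- `G(η,ξ) = ∑ₖ [M_k(η,ξ) - H_k(η,ξ)] + ∑ₖ [V_k(η,ξ) - U_k(η,ξ)]`. -/
def G (R : ℝ) (η ξ : Heis n) : ℝ :=
  (∑' k, (M R η k ξ - H R η k ξ)) + ∑' k, (V R η k ξ - U R η k ξ)

end Heisenberg

end

noncomputable section

namespace Heisenberg

variable {n : ℕ}

/-! ### Dilations, rotations and the gauge -/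

/-! The proof is a method of images. With `P = |z|² + it`, the point `h_R(ξ⁻¹)` equals `R² z / P` in
its first coordinate, so up to a rotation it is the dilation of `ξ` by `R² / N(ξ)²`
(`inversionR_inv`). On circular functions the Kelvin transform followed by `inv` is therefore a
weighted radial reflection, and two reflections compose to a pure dilation (`kelvinR_kelvinR`). The
averaged solution `avgSol η` is homogeneous (`avgSol_dil`) and is turned by the unit reflection into
a multiple of the averaged solution with pole `refl η` (`avgSol_image`). Hence every term is a
constant times an averaged solution: the poles of `M` and `U` are dilates of `η` and `refl η`
shrinking to the origin, those of `H` and `V` are dilates of `refl η` and `η` running to infinity.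
Only the zeroth term of `M`, `avgSol η` itself, has its pole in the annulus.

The coefficients decay geometrically while the dilation parameters stay in a compact set on which
the kernel is jointly smooth. Such a series is an integral against a discrete measure, and
differentiation under the integral makes the sum of all other terms smooth up to both boundary
spheres (`contDiffAt_tsum_of_contDiffOn`, `ImageSeries`).

On `N = 1` the terms cancel as `H_k = M_k`, `U_k = V_k`; on `N = R` they cancel after a shift, `H_k
= M_{k+1}`, `U_0 = M_0`, `U_{k+1} = V_k`. The boundary limits follow by continuity and properness of
the gauge.

The equation reduces to the fundamental solution. The regularization `(|z|² + ε)² + t²` gives an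
explicit approximate identity under `L₀` (`subLaplacian_regSol`), whose mass is computed with
Gaussian integrals (`a0_mul_integral`). Left translation and Fubini over the circle yield
`integral_avgSol_smul_L0`; image poles outside the annulus contribute nothing. -/

/-- The dilation `[z,t] ↦ [s z, s² t]`. -/
def dil (s : ℝ) (ξ : Heis n) : Heis n := (fun j => (s : ℂ) * ξ.1 j, s ^ 2 * ξ.2)

/-- The fourth power of the gauge. -/
def quartic (ξ : Heis n) : ℝ := normSq ξ.1 ^ 2 + ξ.2 ^ 2

/-- The complex coordinate `|z|² + it`, whose modulus is the squared gauge. -/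
def cplx (ξ : Heis n) : ℂ := (normSq ξ.1 : ℂ) + (ξ.2 : ℂ) * Complex.I

theorem normSq_nonneg (z : Fin n → ℂ) : 0 ≤ normSq z :=
  Finset.sum_nonneg fun _ _ => by positivity

theorem normSq_eq_zero {z : Fin n → ℂ} : normSq z = 0 ↔ z = 0 := by
  unfold normSq
  rw [Finset.sum_eq_zero_iff_of_nonneg (fun _ _ => by positivity)]
  simp [funext_iff]

theorem quartic_nonneg (ξ : Heis n) : 0 ≤ quartic ξ := by unfold quartic; positivity

theorem quartic_eq_zero {ξ : Heis n} : quartic ξ = 0 ↔ ξ = 0 := by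
  unfold quartic
  constructor
  · intro h
    have h1 : normSq ξ.1 ^ 2 = 0 := by nlinarith [sq_nonneg (normSq ξ.1), sq_nonneg ξ.2]
    have h2 : ξ.2 ^ 2 = 0 := by nlinarith [sq_nonneg (normSq ξ.1), sq_nonneg ξ.2]
    exact Prod.ext (normSq_eq_zero.1 (pow_eq_zero_iff two_ne_zero |>.1 h1))
      (pow_eq_zero_iff two_ne_zero |>.1 h2)
  · rintro rfl
    simp [normSq]

theorem quartic_pos {ξ : Heis n} (h : ξ ≠ 0) : 0 < quartic ξ :=
  lt_of_le_of_ne (quartic_nonneg ξ) fun h' => h (quartic_eq_zero.1 h'.symm)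

theorem gauge_eq (ξ : Heis n) : gauge ξ = quartic ξ ^ (1 / 4 : ℝ) := rfl

theorem gauge_nonneg (ξ : Heis n) : 0 ≤ gauge ξ := Real.rpow_nonneg (quartic_nonneg ξ) _

theorem gauge_pow_four (ξ : Heis n) : gauge ξ ^ 4 = quartic ξ := by
  rw [gauge_eq, ← Real.rpow_natCast, ← Real.rpow_mul (quartic_nonneg ξ)]
  norm_num

theorem gauge_eq_of_pow_four {ξ : Heis n} {r : ℝ} (hr : 0 ≤ r) (h : quartic ξ = r ^ 4) :
    gauge ξ = r := by
  rw [← gauge_pow_four] at h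
  exact (pow_left_inj₀ (gauge_nonneg ξ) hr (by norm_num)).1 h

theorem gauge_eq_zero {ξ : Heis n} : gauge ξ = 0 ↔ ξ = 0 := by
  rw [← quartic_eq_zero, ← gauge_pow_four, pow_eq_zero_iff (by norm_num)]

theorem gauge_pos {ξ : Heis n} (h : ξ ≠ 0) : 0 < gauge ξ :=
  lt_of_le_of_ne (gauge_nonneg ξ) fun h' => h (gauge_eq_zero.1 h'.symm)

theorem norm_cplx (ξ : Heis n) : ‖cplx ξ‖ = gauge ξ ^ 2 := by
  refine (pow_left_inj₀ (norm_nonneg _) (by positivity) two_ne_zero).1 ?_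
  rw [← Complex.normSq_eq_norm_sq, cplx, Complex.normSq_add_mul_I, ← pow_mul, gauge_pow_four]
  rfl

theorem normSq_smul (c : ℂ) (z : Fin n → ℂ) : normSq (fun j => c * z j) = ‖c‖ ^ 2 * normSq z := by
  simp [normSq, Finset.mul_sum, mul_pow]

theorem quartic_dil (s : ℝ) (ξ : Heis n) : quartic (dil s ξ) = s ^ 4 * quartic ξ := by
  simp only [quartic, dil, normSq_smul, Complex.norm_real, Real.norm_eq_abs, sq_abs]
  ring

theorem gauge_dil {s : ℝ} (hs : 0 ≤ s) (ξ : Heis n) : gauge (dil s ξ) = s * gauge ξ := by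
  apply gauge_eq_of_pow_four (mul_nonneg hs (gauge_nonneg ξ))
  rw [quartic_dil, mul_pow, gauge_pow_four]

theorem dil_dil (s r : ℝ) (ξ : Heis n) : dil s (dil r ξ) = dil (s * r) ξ := by
  ext <;> simp [dil] <;> ring

@[simp] theorem dil_one (ξ : Heis n) : dil 1 ξ = ξ := by
  ext <;> simp [dil]

theorem dil_ne_zero {s : ℝ} (hs : s ≠ 0) {ξ : Heis n} (h : ξ ≠ 0) : dil s ξ ≠ 0 := by
  rw [Ne, ← quartic_eq_zero, quartic_dil]
  exact mul_ne_zero (pow_ne_zero _ hs) (quartic_pos h).ne'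

theorem rot_dil (θ s : ℝ) (ξ : Heis n) : rot θ (dil s ξ) = dil s (rot θ ξ) := by
  ext <;> simp [rot, dil]; ring

theorem rot_rot (θ ψ : ℝ) (ξ : Heis n) : rot θ (rot ψ ξ) = rot (θ + ψ) ξ := by
  ext <;> simp [rot, add_mul, Complex.exp_add]; ring

theorem rot_inv (θ : ℝ) (ξ : Heis n) : rot θ (inv ξ) = inv (rot θ ξ) := by
  ext <;> simp [rot, inv]

theorem normSq_rot (θ : ℝ) (ξ : Heis n) : normSq (rot θ ξ).1 = normSq ξ.1 := by
  have := normSq_smul (Complex.exp (θ * Complex.I)) ξ.1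
  rw [Complex.norm_exp_ofReal_mul_I, one_pow, one_mul] at this
  exact this

theorem quartic_rot (θ : ℝ) (ξ : Heis n) : quartic (rot θ ξ) = quartic ξ := by
  unfold quartic
  rw [normSq_rot]; rfl

theorem gauge_rot (θ : ℝ) (ξ : Heis n) : gauge (rot θ ξ) = gauge ξ := by
  rw [gauge_eq, quartic_rot, ← gauge_eq]

theorem quartic_inv (ξ : Heis n) : quartic (inv ξ) = quartic ξ := by
  simp [quartic, inv, normSq]

theorem gauge_inv (ξ : Heis n) : gauge (inv ξ) = gauge ξ := by
  rw [gauge_eq, quartic_inv, ← gauge_eq]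

theorem gauge_eq_of_mem_orbit {ξ η : Heis n} (h : ξ ∈ orbit η) : gauge ξ = gauge η := by
  obtain ⟨θ, rfl⟩ := h
  exact gauge_rot θ η

theorem rot_periodic (ξ : Heis n) : Function.Periodic (fun θ : ℝ => rot θ ξ) (2 * Real.pi) := by
  intro θ
  have : Complex.exp (((θ + 2 * Real.pi : ℝ) : ℂ) * Complex.I) = Complex.exp (θ * Complex.I) := by
    push_cast
    rw [add_mul, Complex.exp_add, Complex.exp_two_pi_mul_I, mul_one]
  simp only [rot, this]

theorem isCircular_circAvg {E : Type*} [NormedAddCommGroup E] [NormedSpace ℝ E] (f : Heis n → E) :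
    IsCircular (circAvg f) := by
  intro θ ξ
  unfold circAvg
  simp only [rot_rot]
  congr 1
  have hp : Function.Periodic (fun ψ : ℝ => f (rot ψ ξ)) (2 * Real.pi) :=
    (rot_periodic ξ).comp f
  rw [intervalIntegral.integral_comp_add_right (fun ψ => f (rot ψ ξ)) θ]
  rw [zero_add, add_comm, hp.intervalIntegral_add_eq θ 0, zero_add]

theorem circAvg_of_isCircular {E : Type*} [NormedAddCommGroup E] [NormedSpace ℝ E]
    [CompleteSpace E] {f : Heis n → E}
    (hf : IsCircular f) : circAvg f = f := by
  ext ξ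
  have h : ∀ θ : ℝ, f (rot θ ξ) = f ξ := fun θ => hf θ ξ
  have : (2 * Real.pi) ≠ 0 := by positivity
  rw [circAvg]
  simp only [h, intervalIntegral.integral_const, sub_zero, smul_smul]
  rw [inv_mul_cancel₀ this, one_smul]

/-! ### Kelvin transforms of circular functions -/

/-- Replacing `ξ` by its inverse changes the denominator `|z|² - it` into `cplx ξ`, of modulus
`N(ξ)²`; dividing by it scales by `N(ξ)⁻²` and rotates by minus its argument. -/
theorem inversionR_inv {R : ℝ} {ξ : Heis n} (hξ : ξ ≠ 0) :
    ∃ θ : ℝ, inversionR R (inv ξ) = rot θ (dil (R ^ 2 / gauge ξ ^ 2) ξ) := by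
  have hP : cplx ξ ≠ 0 := by
    rw [← norm_ne_zero_iff, norm_cplx]; exact pow_ne_zero _ (gauge_pos hξ).ne'
  have hN : ((gauge ξ : ℝ) : ℂ) ≠ 0 := by exact_mod_cast (gauge_pos hξ).ne'
  refine ⟨-(cplx ξ).arg, ?_⟩
  have h1 := Complex.norm_mul_exp_arg_mul_I (cplx ξ)
  rw [norm_cplx] at h1
  have hexp : Complex.exp (((-(cplx ξ).arg : ℝ) : ℂ) * Complex.I) = (gauge ξ : ℂ) ^ 2 / cplx ξ := by
    rw [eq_div_iff hP]
    generalize (cplx ξ).arg = α at h1 ⊢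
    rw [← h1]
    push_cast
    rw [mul_left_comm, ← Complex.exp_add]
    simp
  have hq : normSq (inv ξ).1 = normSq ξ.1 := by simp [inv, normSq]
  have hden : ((normSq (inv ξ).1 : ℂ) - Complex.I * ((inv ξ).2 : ℂ)) = cplx ξ := by
    rw [hq]; simp [inv, cplx]; ring
  ext j
  · simp only [inversionR, rot, dil, hexp, hden, Pi.smul_apply, smul_eq_mul]
    simp [inv]
    field_simp
  · have : gauge ξ ≠ 0 := (gauge_pos hξ).ne'
    have h4 : normSq (inv ξ).1 ^ 2 + (inv ξ).2 ^ 2 = gauge ξ ^ 4 := by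
      rw [gauge_pow_four]; exact quartic_inv ξ
    simp only [inversionR, rot, dil, h4]
    simp [inv]
    field_simp

theorem kelvinR_inv {f : Heis n → ℝ} (hf : IsCircular f) (R : ℝ) {ξ : Heis n} (hξ : ξ ≠ 0) :
    kelvinR R f (inv ξ) =
      R ^ (2 * n) * (gauge ξ ^ (2 * n))⁻¹ * f (dil (R ^ 2 / gauge ξ ^ 2) ξ) := by
  obtain ⟨θ, h⟩ := inversionR_inv (R := R) hξ
  rw [kelvinR, h, hf, gauge_inv]

theorem kelvin_eq_kelvinR_one (f : Heis n → ℝ) : kelvin f = kelvinR 1 f := by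
  ext ξ
  simp [kelvin, kelvinR, inversion, inversionR]

theorem isCircular_kelvinR {f : Heis n → ℝ} (hf : IsCircular f) (R : ℝ) :
    IsCircular (kelvinR R f ∘ inv) := by
  intro θ ξ
  have : inversionR R (rot θ (inv ξ)) = rot θ (inversionR R (inv ξ)) := by
    simp only [inversionR, normSq_rot]
    ext <;> simp [rot]; ring
  simp only [Function.comp, ← rot_inv, kelvinR, this, gauge_rot]
  rw [hf θ]

/-- Along each dilation orbit both maps send the gauge `N` to a constant over `N`, so the dependence
of the dilation factor and of the weight on `N(ξ)` cancels in the composite. -/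
theorem kelvinR_kelvinR {f : Heis n → ℝ} (hf : IsCircular f) {R S : ℝ} (hR : R ≠ 0)
    {ξ : Heis n} (hξ : ξ ≠ 0) :
    kelvinR R (kelvinR S f ∘ inv) (inv ξ) =
      (S ^ (2 * n) * (R ^ (2 * n))⁻¹) * f (dil (S ^ 2 / R ^ 2) ξ) := by
  have hN := (gauge_pos hξ).ne'
  have hc : R ^ 2 / gauge ξ ^ 2 ≠ 0 := by positivity
  rw [kelvinR_inv (isCircular_kelvinR hf S) _ hξ, Function.comp,
    kelvinR_inv hf _ (dil_ne_zero hc hξ), dil_dil, gauge_dil (by positivity)]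
  have h1 : S ^ 2 / (R ^ 2 / gauge ξ ^ 2 * gauge ξ) ^ 2 * (R ^ 2 / gauge ξ ^ 2) = S ^ 2 / R ^ 2 := by
    field_simp
  have h2 : (R ^ 2 / gauge ξ ^ 2 * gauge ξ) = R ^ 2 / gauge ξ := by field_simp
  rw [h1, h2, ← _root_.mul_assoc]
  congr 1
  rw [div_pow, pow_right_comm R 2 (2 * n)]
  field_simp

/-! ### Circular averages of the fundamental solution -/

/-- The circular average of the fundamental solution with pole at `η`. -/
abbrev avgSol (η : Heis n) : Heis n → ℝ := circAvg (fundSolAt η)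

theorem isCircular_avgSol (η : Heis n) : IsCircular (avgSol η) := isCircular_circAvg _

theorem fundSol_eq (ξ : Heis n) : fundSol ξ = a0 n * quartic ξ ^ (-((n : ℝ) / 2)) := rfl

theorem rpow_quartic_scale {q r X : ℝ} (hr : 0 < r) (hX : 0 ≤ X) (h : q = r ^ 4 * X) :
    q ^ (-((n : ℝ) / 2)) = (r ^ (2 * n))⁻¹ * X ^ (-((n : ℝ) / 2)) := by
  rw [h, Real.mul_rpow (by positivity) hX, ← Real.rpow_natCast r 4, ← Real.rpow_mul hr.le,
    ← Real.rpow_natCast r (2 * n), ← Real.rpow_neg hr.le]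
  congr 2
  push_cast
  ring

theorem dil_mul (s : ℝ) (ξ η : Heis n) : mul (dil s ξ) (dil s η) = dil s (mul ξ η) := by
  have : dotConj (dil s ξ).1 (dil s η).1 = ((s ^ 2 : ℝ) : ℂ) * dotConj ξ.1 η.1 := by
    simp only [dotConj, dil, Finset.mul_sum]
    refine Finset.sum_congr rfl fun j _ => ?_
    simp
    ring
  refine Prod.ext ?_ ?_
  · funext j
    simp [mul, dil]
    ring
  · simp only [mul, this, Complex.im_ofReal_mul]
    simp [dil]
    ring

theorem rot_mul (θ : ℝ) (ξ η : Heis n) : mul (rot θ ξ) (rot θ η) = rot θ (mul ξ η) := by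
  have h1 : Complex.exp (θ * Complex.I) * (starRingEnd ℂ) (Complex.exp (θ * Complex.I)) = 1 := by
    rw [Complex.mul_conj, Complex.normSq_eq_norm_sq, Complex.norm_exp_ofReal_mul_I]; simp
  have : dotConj (rot θ ξ).1 (rot θ η).1 = dotConj ξ.1 η.1 := by
    simp only [dotConj, rot]
    refine Finset.sum_congr rfl fun j _ => ?_
    simp only [Pi.smul_apply, smul_eq_mul, map_mul]
    linear_combination (ξ.1 j * (starRingEnd ℂ) (η.1 j)) * h1
  refine Prod.ext ?_ ?_
  · funext j
    simp [mul, rot]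
  · simp only [mul, this]
    simp [rot]

theorem inv_dil (s : ℝ) (ξ : Heis n) : inv (dil s ξ) = dil s (inv ξ) := by
  ext <;> simp [inv, dil]

theorem fundSolAt_rot (θ : ℝ) (η ξ : Heis n) :
    fundSolAt η (rot θ ξ) = fundSolAt (rot (-θ) η) ξ := by
  have : η = rot θ (rot (-θ) η) := by rw [rot_rot]; simp [rot]
  conv_lhs => rw [this]
  rw [fundSolAt, ← rot_inv, rot_mul, fundSolAt, fundSol_eq, quartic_rot, ← fundSol_eq]

/-- Dilations are group automorphisms commuting with rotations, and the kernel is homogeneous of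
degree `-2n`. This lets a dilation move freely between pole and argument. -/
theorem avgSol_dil {s : ℝ} (hs : 0 < s) (η ξ : Heis n) :
    avgSol η (dil s ξ) = (s ^ (2 * n))⁻¹ * avgSol (dil s⁻¹ η) ξ := by
  have h : ∀ θ : ℝ, fundSolAt η (rot θ (dil s ξ)) =
      (s ^ (2 * n))⁻¹ * fundSolAt (dil s⁻¹ η) (rot θ ξ) := by
    intro θ
    have h1 : η = dil s (dil s⁻¹ η) := by rw [dil_dil, mul_inv_cancel₀ hs.ne', dil_one]
    conv_lhs => rw [h1]
    rw [fundSolAt, rot_dil, inv_dil, dil_mul, fundSol_eq, fundSolAt, fundSol_eq,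
      rpow_quartic_scale hs (quartic_nonneg _) (quartic_dil s _)]
    ring
  simp only [circAvg, h, intervalIntegral.integral_const_mul, smul_eq_mul]
  ring

/-- Writing the fourth power of the gauge distance as the squared modulus of one complex number
reduces the image formula to multiplication by a complex factor of known modulus. -/
theorem quartic_inv_mul (ξ η : Heis n) : quartic (mul (inv ξ) η) =
    ‖cplx ξ + (starRingEnd ℂ) (cplx η) - 2 * (starRingEnd ℂ) (dotConj ξ.1 η.1)‖ ^ 2 := by
  have h1 : normSq (-ξ.1 + η.1) = normSq ξ.1 + normSq η.1 - 2 * (dotConj ξ.1 η.1).re := by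
    simp only [normSq, dotConj, Complex.re_sum, Finset.mul_sum, ← Finset.sum_add_distrib,
      ← Finset.sum_sub_distrib]
    refine Finset.sum_congr rfl fun j _ => ?_
    simp only [← Complex.normSq_eq_norm_sq, Complex.normSq_apply]
    simp
    ring
  have h2 : (dotConj (-ξ.1) η.1).im = -(dotConj ξ.1 η.1).im := by
    simp [dotConj]
  rw [← Complex.normSq_eq_norm_sq, Complex.normSq_apply]
  simp only [quartic, mul, inv, h1, h2]
  simp [cplx]
  ring

/-- Both integrals run once around the circle of radius `‖A‖`, from different starting points and in
opposite directions. -/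
theorem intervalIntegral_circle_eq (F : ℂ → ℝ) {A B : ℂ} (h : ‖A‖ = ‖B‖) :
    ∫ θ in (0 : ℝ)..(2 * Real.pi), F (Complex.exp (θ * Complex.I) * A) =
      ∫ θ in (0 : ℝ)..(2 * Real.pi), F (Complex.exp (((-θ : ℝ) : ℂ) * Complex.I) * B) := by
  let g : ℝ → ℝ := fun θ => F (‖A‖ * Complex.exp (θ * Complex.I))
  have hg : Function.Periodic g (2 * Real.pi) := by
    intro θ
    simp only [g]
    push_cast
    rw [add_mul, Complex.exp_add, Complex.exp_two_pi_mul_I, mul_one]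
  have h1 : ∀ θ : ℝ, F (Complex.exp (θ * Complex.I) * A) = g (θ + A.arg) := by
    intro θ
    simp only [g]
    conv_lhs => rw [← Complex.norm_mul_exp_arg_mul_I A]
    push_cast
    rw [add_mul, Complex.exp_add]
    ring_nf
  have h2 : ∀ θ : ℝ, F (Complex.exp (((-θ : ℝ) : ℂ) * Complex.I) * B) = g (B.arg - θ) := by
    intro θ
    simp only [g]
    conv_lhs => rw [← Complex.norm_mul_exp_arg_mul_I B, ← h]
    push_cast
    rw [sub_eq_add_neg, add_mul, Complex.exp_add]
    ring_nf
  simp only [h1, h2]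
  rw [intervalIntegral.integral_comp_add_right g, intervalIntegral.integral_comp_sub_left g,
    zero_add, add_comm, hg.intervalIntegral_add_eq _ 0, zero_add, sub_zero]
  have := hg.intervalIntegral_add_eq (B.arg - 2 * Real.pi) 0
  rw [sub_add_cancel, zero_add] at this
  exact this.symm

/-- Inversion of the average fundamental solution in the unit sphere: method of images. -/
theorem avgSol_image {η ξ : Heis n} (hη : η ≠ 0) (hξ : ξ ≠ 0) :
    (gauge ξ ^ (2 * n))⁻¹ * avgSol η (dil (gauge ξ ^ 2)⁻¹ ξ) =
      (gauge η ^ (2 * n))⁻¹ * avgSol (dil (gauge η ^ 2)⁻¹ η) ξ := by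
  have hN := gauge_pos hξ
  have hN' := gauge_pos hη
  set P := cplx ξ with hP
  set Q := cplx η with hQ
  set w := dotConj ξ.1 η.1 with hw
  have hPn : P * (starRingEnd ℂ) P = (gauge ξ : ℂ) ^ 4 := by
    rw [Complex.mul_conj, Complex.normSq_eq_norm_sq, norm_cplx]; push_cast; ring
  have hQn : Q * (starRingEnd ℂ) Q = (gauge η : ℂ) ^ 4 := by
    rw [Complex.mul_conj, Complex.normSq_eq_norm_sq, norm_cplx]; push_cast; ring
  have hPn' : ‖P‖ = gauge ξ ^ 2 := norm_cplx ξ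
  have hQn' : ‖Q‖ = gauge η ^ 2 := norm_cplx η
  set sξ : ℝ := (gauge ξ ^ 2)⁻¹ with hsξ
  set sη : ℝ := (gauge η ^ 2)⁻¹ with hsη
  have hs1 : (sξ : ℂ) ^ 2 * (gauge ξ : ℂ) ^ 4 = 1 := by
    have : sξ ^ 2 * gauge ξ ^ 4 = 1 := by rw [hsξ]; field_simp
    exact_mod_cast this
  have hs2 : (sη : ℂ) ^ 2 * (gauge η : ℂ) ^ 4 = 1 := by
    have : sη ^ 2 * gauge η ^ 4 = 1 := by rw [hsη]; field_simp
    exact_mod_cast this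
  have hcd : ∀ (s : ℝ) (ζ : Heis n), cplx (dil s ζ) = (s : ℂ) ^ 2 * cplx ζ := by
    intro s ζ
    simp only [cplx, dil, normSq_smul, Complex.norm_real, Real.norm_eq_abs, sq_abs]
    push_cast; ring
  have hcr : ∀ (θ : ℝ) (ζ : Heis n), cplx (rot θ ζ) = cplx ζ := by
    intro θ ζ
    simp only [cplx, normSq_rot]; rfl
  have hdl : ∀ (a : ℂ) (z v : Fin n → ℂ), dotConj (fun j => a * z j) v = a * dotConj z v := by
    intro a z v
    simp [dotConj, Finset.mul_sum, _root_.mul_assoc]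
  have hdr : ∀ (a : ℝ) (z v : Fin n → ℂ), dotConj z (fun j => (a : ℂ) * v j) = a * dotConj z v := by
    intro a z v
    simp only [dotConj, Finset.mul_sum]
    refine Finset.sum_congr rfl fun j _ => ?_
    simp; ring
  have hdrot : ∀ (θ : ℝ) (ζ υ : Heis n), dotConj (rot θ ζ).1 υ.1 =
      Complex.exp (θ * Complex.I) * dotConj ζ.1 υ.1 := fun θ ζ υ => hdl _ _ _
  have hconj : ∀ θ : ℝ, (starRingEnd ℂ) (Complex.exp (θ * Complex.I)) =
      Complex.exp (((-θ : ℝ) : ℂ) * Complex.I) := by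
    intro θ
    rw [← Complex.exp_conj]; simp
  -- Multiplying the complex number of `quartic_inv_mul` by `P̄` on the left side and by `Q` on the
  -- right side brings both kernels to this common form, up to conjugation; `u` then runs over a
  -- circle centred at the origin.
  let F : ℂ → ℝ := fun u => a0 n * (‖1 + P * Q - 2 * u‖ ^ 2) ^ (-((n : ℝ) / 2))
  have hL : ∀ θ : ℝ, fundSolAt η (rot θ (dil sξ ξ)) =
      gauge ξ ^ (2 * n) * F (Complex.exp (θ * Complex.I) * (sξ * P * w)) := by
    intro θ
    have : quartic (mul (inv (rot θ (dil sξ ξ))) η) = (gauge ξ)⁻¹ ^ 4 *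
        ‖1 + P * Q - 2 * (Complex.exp (θ * Complex.I) * (sξ * P * w))‖ ^ 2 := by
      rw [quartic_inv_mul, hcr, hcd, hdrot]
      have : dotConj (dil sξ ξ).1 η.1 = sξ * w := hdl _ _ _
      rw [this, inv_pow, eq_inv_mul_iff_mul_eq₀ (by positivity),
        ← hP, ← hQ,
        show gauge ξ ^ 4 = ‖(starRingEnd ℂ) P‖ ^ 2 by rw [Complex.norm_conj, hPn']; ring, ← mul_pow, ← norm_mul]
      congr 1
      rw [← Complex.norm_conj]
      congr 1
      simp only [map_add, map_sub, map_mul, map_pow, map_ofNat, Complex.conj_conj,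
        Complex.conj_ofReal]
      linear_combination hs1 + (sξ : ℂ) ^ 2 * hPn
    rw [fundSolAt, fundSol_eq, rpow_quartic_scale (inv_pos.2 hN) (by positivity) this]
    simp only [F, inv_pow, inv_inv]
    ring
  have hR : ∀ θ : ℝ, fundSolAt (dil sη η) (rot θ ξ) =
      gauge η ^ (2 * n) * F (Complex.exp (((-θ : ℝ) : ℂ) * Complex.I) *
        (sη * Q * (starRingEnd ℂ) w)) := by
    intro θ
    have : quartic (mul (inv (rot θ ξ)) (dil sη η)) = (gauge η)⁻¹ ^ 4 *
        ‖1 + P * Q - 2 * (Complex.exp (((-θ : ℝ) : ℂ) * Complex.I) *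
          (sη * Q * (starRingEnd ℂ) w))‖ ^ 2 := by
      rw [quartic_inv_mul, hcr, hcd, hdrot]
      have : dotConj ξ.1 (dil sη η).1 = sη * w := hdr _ _ _
      rw [this, inv_pow, eq_inv_mul_iff_mul_eq₀ (by positivity),
        ← hP, ← hQ,
        show gauge η ^ 4 = ‖Q‖ ^ 2 by rw [hQn']; ring, ← mul_pow, ← norm_mul]
      congr 2
      simp only [map_mul, map_pow, Complex.conj_ofReal, hconj]
      linear_combination hs2 + (sη : ℂ) ^ 2 * hQn
    rw [fundSolAt, fundSol_eq, rpow_quartic_scale (inv_pos.2 hN') (by positivity) this]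
    simp only [F, inv_pow, inv_inv]
    ring
  -- Both radii equal `‖w‖`, so the circle averages agree.
  have hAB : ‖(sξ : ℂ) * P * w‖ = ‖(sη : ℂ) * Q * (starRingEnd ℂ) w‖ := by
    rw [norm_mul, norm_mul, norm_mul, norm_mul, hPn', hQn', Complex.norm_conj, hsξ, hsη]
    simp only [Complex.norm_real, norm_inv, norm_pow, Real.norm_eq_abs, sq_abs]
    field_simp
  simp only [circAvg, hL, hR, intervalIntegral.integral_const_mul, smul_eq_mul]
  rw [intervalIntegral_circle_eq F hAB, mul_left_comm, mul_left_comm (gauge η ^ (2 * n))⁻¹,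
    inv_mul_cancel_left₀ (by positivity), inv_mul_cancel_left₀ (by positivity)]

/-! ### The four families in terms of images -/

/-- The image of `η` under `ξ ↦ N(ξ)⁻² ξ`. -/
def refl (η : Heis n) : Heis n := dil (gauge η ^ 2)⁻¹ η

theorem gauge_refl {η : Heis n} (hη : η ≠ 0) : gauge (refl η) = (gauge η)⁻¹ := by
  have := gauge_pos hη
  rw [refl, gauge_dil (by positivity)]
  field_simp

theorem kelvinR_kelvin {f : Heis n → ℝ} (hf : IsCircular f) {R : ℝ} (hR : R ≠ 0)
    {ξ : Heis n} (hξ : ξ ≠ 0) :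
    (kelvinR R (kelvin f ∘ inv) ∘ inv) ξ = (R ^ (2 * n))⁻¹ * f (dil (R ^ 2)⁻¹ ξ) := by
  rw [kelvin_eq_kelvinR_one, Function.comp, kelvinR_kelvinR hf hR hξ]
  simp

theorem kelvin_kelvinR {f : Heis n → ℝ} (hf : IsCircular f) {R : ℝ}
    {ξ : Heis n} (hξ : ξ ≠ 0) :
    (kelvin (kelvinR R f ∘ inv) ∘ inv) ξ = R ^ (2 * n) * f (dil (R ^ 2) ξ) := by
  rw [kelvin_eq_kelvinR_one, Function.comp, kelvinR_kelvinR hf one_ne_zero hξ]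
  simp

theorem isCircular_kelvin {f : Heis n → ℝ} (hf : IsCircular f) : IsCircular (kelvin f ∘ inv) := by
  rw [kelvin_eq_kelvinR_one]
  exact isCircular_kelvinR hf 1

theorem isCircular_M (R : ℝ) (η : Heis n) : ∀ k, IsCircular (M R η k)
  | 0 => isCircular_circAvg _
  | k + 1 => isCircular_kelvinR (isCircular_kelvin (isCircular_M R η k)) R

theorem isCircular_H (R : ℝ) (η : Heis n) : ∀ k, IsCircular (H R η k)
  | 0 => isCircular_kelvin (isCircular_circAvg _)
  | k + 1 => isCircular_kelvin (isCircular_kelvinR (isCircular_H R η k) R)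

theorem isCircular_U (R : ℝ) (η : Heis n) : ∀ k, IsCircular (U R η k)
  | 0 => isCircular_kelvinR (isCircular_circAvg _) R
  | k + 1 => isCircular_kelvinR (isCircular_kelvin (isCircular_U R η k)) R

theorem isCircular_V (R : ℝ) (η : Heis n) : ∀ k, IsCircular (V R η k)
  | 0 => isCircular_kelvin (isCircular_kelvinR (isCircular_circAvg _) R)
  | k + 1 => isCircular_kelvin (isCircular_kelvinR (isCircular_V R η k) R)

variable {R : ℝ}

theorem avgSol_dil_inv_sq (hR : 0 < R) (η ξ : Heis n) :
    (R ^ (2 * n))⁻¹ * avgSol η (dil (R ^ 2)⁻¹ ξ) = R ^ (2 * n) * avgSol (dil (R ^ 2) η) ξ := by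
  rw [avgSol_dil (by positivity), inv_inv, inv_pow, inv_inv, pow_right_comm]
  field_simp

/-- Each recursion step dilates the argument by `R⁻²`; homogeneity moves this to a contraction of
the pole, with a gain of `R ^ (2 * n)`. -/
theorem M_eq (hR : 0 < R) (η : Heis n) (k : ℕ) {ξ : Heis n} (hξ : ξ ≠ 0) :
    M R η k ξ = (R ^ (2 * n)) ^ k * avgSol (dil ((R ^ 2) ^ k) η) ξ := by
  induction k generalizing ξ with
  | zero => simp [M]
  | succ k ih =>
    rw [M, kelvinR_kelvin (isCircular_M R η k) hR.ne' hξ, ih (dil_ne_zero (by positivity) hξ),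
      mul_left_comm, avgSol_dil_inv_sq hR, dil_dil, pow_succ' (R ^ 2) k, pow_succ]
    ring

theorem V_eq (hR : 0 < R) (η : Heis n) (k : ℕ) {ξ : Heis n} (hξ : ξ ≠ 0) :
    V R η k ξ = (R ^ (2 * n)) ^ (k + 1) * avgSol η (dil ((R ^ 2) ^ (k + 1)) ξ) := by
  induction k generalizing ξ with
  | zero => rw [V, kelvin_kelvinR (isCircular_avgSol η) hξ]; simp
  | succ k ih =>
    rw [V, kelvin_kelvinR (isCircular_V R η k) hξ, ih (dil_ne_zero (by positivity) hξ),
      dil_dil, pow_succ (R ^ 2) (k + 1), pow_succ _ (k + 1)]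
    ring

theorem H_eq (hR : 0 < R) {η : Heis n} (hη : η ≠ 0) (k : ℕ) {ξ : Heis n} (hξ : ξ ≠ 0) :
    H R η k ξ = (R ^ (2 * n)) ^ k *
      ((gauge η ^ (2 * n))⁻¹ * avgSol (refl η) (dil ((R ^ 2) ^ k) ξ)) := by
  induction k generalizing ξ with
  | zero =>
    rw [H, kelvin_eq_kelvinR_one, Function.comp, kelvinR_inv (isCircular_avgSol η) _ hξ]
    simpa [refl] using avgSol_image hη hξ
  | succ k ih =>
    rw [H, kelvin_kelvinR (isCircular_H R η k) hξ, ih (dil_ne_zero (by positivity) hξ),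
      dil_dil, pow_succ (R ^ 2) k, pow_succ _ k]
    ring

theorem U_eq (hR : 0 < R) {η : Heis n} (hη : η ≠ 0) (k : ℕ) {ξ : Heis n} (hξ : ξ ≠ 0) :
    U R η k ξ = (R ^ (2 * n)) ^ (k + 1) *
      ((gauge η ^ (2 * n))⁻¹ * avgSol (dil ((R ^ 2) ^ (k + 1)) (refl η)) ξ) := by
  induction k generalizing ξ with
  | zero =>
    have hN := gauge_pos hξ
    -- Reflection in the sphere of radius `R` is the unit reflection preceded by the dilation by
    -- `R⁻²`, hence the image formula at the dilated point.
    have h := avgSol_image hη (dil_ne_zero (inv_ne_zero (pow_ne_zero 2 hR.ne')) hξ)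
    rw [dil_dil, gauge_dil (by positivity)] at h
    have h1 : (((R ^ 2)⁻¹ * gauge ξ) ^ 2)⁻¹ * (R ^ 2)⁻¹ = R ^ 2 / gauge ξ ^ 2 := by field_simp
    rw [h1, ← refl] at h
    rw [U, Function.comp, kelvinR_inv (isCircular_avgSol η) _ hξ]
    have h2 : R ^ (2 * n) * (gauge ξ ^ (2 * n))⁻¹ =
        (R ^ (2 * n))⁻¹ * (((R ^ 2)⁻¹ * gauge ξ) ^ (2 * n))⁻¹ := by
      rw [mul_pow, inv_pow, pow_right_comm]
      field_simp
    rw [h2, _root_.mul_assoc, h, mul_left_comm, avgSol_dil_inv_sq hR]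
    simp only [zero_add, pow_one]
    ring
  | succ k ih =>
    rw [U, kelvinR_kelvin (isCircular_U R η k) hR.ne' hξ, ih (dil_ne_zero (by positivity) hξ)]
    have := avgSol_dil_inv_sq hR (dil ((R ^ 2) ^ (k + 1)) (refl η)) ξ
    rw [dil_dil, ← pow_succ' (R ^ 2) (k + 1)] at this
    rw [pow_succ _ (k + 1), _root_.mul_assoc _ (R ^ (2 * n)), mul_left_comm (R ^ (2 * n)), ← this]
    ring

/-! ### Boundary relations -/

/-- Trades the pole `refl η` for a dilate of `η` depending on `N(ξ)`. On a boundary sphere that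
dilation is constant, so all four families become comparable. -/
theorem avgSol_refl_dil {η : Heis n} (hη : η ≠ 0) {s : ℝ} (hs : 0 < s) {ξ : Heis n} (hξ : ξ ≠ 0) :
    (gauge η ^ (2 * n))⁻¹ * avgSol (refl η) (dil s ξ) =
      gauge ξ ^ (2 * n) * avgSol (dil (s * gauge ξ ^ 2) η) ξ := by
  have hN := gauge_pos hξ
  rw [refl, ← avgSol_image hη (dil_ne_zero hs.ne' hξ), dil_dil, gauge_dil hs.le,
    show ((s * gauge ξ) ^ 2)⁻¹ * s = (s * gauge ξ ^ 2)⁻¹ by field_simp,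
    avgSol_dil (by positivity), inv_inv, ← _root_.mul_assoc]
  congr 1
  rw [inv_pow, inv_inv, mul_pow, mul_pow, pow_right_comm _ 2 (2 * n)]
  field_simp

theorem H_eq' (hR : 0 < R) {η : Heis n} (hη : η ≠ 0) (k : ℕ) {ξ : Heis n} (hξ : ξ ≠ 0) :
    H R η k ξ = (R ^ (2 * n)) ^ k * (gauge ξ ^ (2 * n) *
      avgSol (dil ((R ^ 2) ^ k * gauge ξ ^ 2) η) ξ) := by
  rw [H_eq hR hη k hξ, avgSol_refl_dil hη (by positivity) hξ]

theorem V_eq' (hR : 0 < R) (η : Heis n) (k : ℕ) {ξ : Heis n} (hξ : ξ ≠ 0) :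
    V R η k ξ = ((R ^ (2 * n)) ^ (k + 1))⁻¹ * avgSol (dil ((R ^ 2) ^ (k + 1))⁻¹ η) ξ := by
  rw [V_eq hR η k hξ, avgSol_dil (by positivity), ← _root_.mul_assoc]
  congr 1
  field_simp
  simp only [← pow_mul]
  congr 1
  ring

theorem U_eq' (hR : 0 < R) {η : Heis n} (hη : η ≠ 0) (k : ℕ) {ξ : Heis n} (hξ : ξ ≠ 0) :
    U R η k ξ = ((R ^ (2 * n)) ^ (k + 1))⁻¹ * (gauge ξ ^ (2 * n) *
      avgSol (dil (((R ^ 2) ^ (k + 1))⁻¹ * gauge ξ ^ 2) η) ξ) := by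
  have h := avgSol_dil (s := ((R ^ 2) ^ (k + 1))⁻¹) (by positivity) (refl η) ξ
  rw [inv_inv, inv_mul_eq_div, eq_div_iff (by positivity), mul_comm] at h
  rw [U_eq hR hη k hξ, ← h, mul_left_comm (gauge η ^ (2 * n))⁻¹,
    avgSol_refl_dil hη (by positivity) hξ, ← _root_.mul_assoc]
  congr 1
  rw [inv_pow]
  field_simp
  simp only [← pow_mul]
  congr 1
  ring

theorem ne_zero_of_gauge_eq {ξ : Heis n} {r : ℝ} (hr : 0 < r) (h : gauge ξ = r) : ξ ≠ 0 := by
  rintro rfl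
  rw [gauge_eq_zero.2 rfl] at h
  exact hr.ne h

theorem H_eq_M (hR : 0 < R) {η : Heis n} (hη : η ≠ 0) (k : ℕ) {ξ : Heis n} (hξ : gauge ξ = 1) :
    H R η k ξ = M R η k ξ := by
  have h0 := ne_zero_of_gauge_eq one_pos hξ
  rw [H_eq' hR hη k h0, M_eq hR η k h0, hξ]
  simp

theorem U_eq_V (hR : 0 < R) {η : Heis n} (hη : η ≠ 0) (k : ℕ) {ξ : Heis n} (hξ : gauge ξ = 1) :
    U R η k ξ = V R η k ξ := by
  have h0 := ne_zero_of_gauge_eq one_pos hξ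
  rw [U_eq' hR hη k h0, V_eq' hR η k h0, hξ]
  simp

/-- On the inner sphere the factor `N(ξ)² = R²` supplies one more power in the pole, which is the
source of the index shift. -/
theorem H_eq_M_succ (hR : 0 < R) {η : Heis n} (hη : η ≠ 0) (k : ℕ) {ξ : Heis n}
    (hξ : gauge ξ = R) : H R η k ξ = M R η (k + 1) ξ := by
  have h0 := ne_zero_of_gauge_eq hR hξ
  rw [H_eq' hR hη k h0, M_eq hR η (k + 1) h0, hξ, pow_succ (R ^ 2) k,
    pow_succ (R ^ (2 * n)) k, _root_.mul_assoc]

theorem U_zero_eq_M (hR : 0 < R) {η : Heis n} (hη : η ≠ 0) {ξ : Heis n}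
    (hξ : gauge ξ = R) : U R η 0 ξ = M R η 0 ξ := by
  have h0 := ne_zero_of_gauge_eq hR hξ
  rw [U_eq' hR hη 0 h0, M_eq hR η 0 h0, hξ, ← _root_.mul_assoc]
  simp [hR.ne']

theorem U_succ_eq_V (hR : 0 < R) {η : Heis n} (hη : η ≠ 0) (k : ℕ) {ξ : Heis n}
    (hξ : gauge ξ = R) : U R η (k + 1) ξ = V R η k ξ := by
  have h0 := ne_zero_of_gauge_eq hR hξ
  rw [U_eq' hR hη (k + 1) h0, V_eq' hR η k h0, hξ, pow_succ (R ^ 2) (k + 1),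
    pow_succ (R ^ (2 * n)) (k + 1), ← _root_.mul_assoc]
  congr 2
  · field_simp
  · field_simp

end Heisenberg
end

noncomputable section

/-! ### Smooth dependence of integrals and series on a parameter -/

section Parametric

open MeasureTheory Set Filter Topology

universe u v

variable {P : Type v} [NormedAddCommGroup P] [NormedSpace ℝ P] [MeasurableSpace P] [BorelSpace P]
  [SecondCountableTopology P]

/-- The tube lemma extends a bound on `K ×ˢ C` to an open neighbourhood of `C`, uniformly in the
parameter. It gives the dominating constants for differentiation and the majorants of the series. -/
theorem exists_bound_near_compact {P E F : Type*} [TopologicalSpace P] [TopologicalSpace E]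
    [NormedAddCommGroup F] {K : Set P} (hK : IsCompact K) {C : Set E} (hC : IsCompact C)
    {V : Set (P × E)} (hV : IsOpen V)
    {g : P × E → F} (hg : ContinuousOn g V) (hKV : K ×ˢ C ⊆ V) :
    ∃ B : ℝ, ∃ u : Set E, IsOpen u ∧ C ⊆ u ∧ ∀ p ∈ K, ∀ x ∈ u, (p, x) ∈ V ∧ ‖g (p, x)‖ ≤ B := by
  obtain ⟨B, hB⟩ := (hK.prod hC).exists_bound_of_continuousOn (hg.mono hKV)
  have ho : IsOpen (V ∩ (fun y => ‖g y‖) ⁻¹' Iio (B + 1)) := hg.norm.isOpen_inter_preimage hV isOpen_Iio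
  have hsub : K ×ˢ C ⊆ V ∩ (fun y => ‖g y‖) ⁻¹' Iio (B + 1) := fun y hy =>
    ⟨hKV hy, lt_of_le_of_lt (hB y hy) (lt_add_one B)⟩
  obtain ⟨w, u, hw, hu, hKw, hCu, h⟩ := generalized_tube_lemma hK hC ho hsub
  refine ⟨B + 1, u, hu, hCu, fun p hp x hx => ?_⟩
  have := h (mk_mem_prod (hKw hp) hx)
  exact ⟨this.1, (mem_preimage.1 this.2).le⟩

theorem hasFDerivAt_setIntegral_of_contDiffOn {E F : Type u} [NormedAddCommGroup E]
    [NormedSpace ℝ E] [NormedAddCommGroup F] [NormedSpace ℝ F]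
    {K : Set P} (hK : IsCompact K) (μ : Measure P) [IsFiniteMeasureOnCompacts μ]
    {V : Set (P × E)} (hV : IsOpen V) {f : P × E → F} (hf : ContDiffOn ℝ ∞ f V) {ξ : E}
    (hKV : K ×ˢ {ξ} ⊆ V) :
    HasFDerivAt (fun x => ∫ p in K, f (p, x) ∂μ)
      (∫ p in K, (fderiv ℝ f (p, ξ)).comp (ContinuousLinearMap.inr ℝ P E) ∂μ) ξ := by
  have hf' : ContinuousOn (fun y => (fderiv ℝ f y).comp (ContinuousLinearMap.inr ℝ P E)) V :=
    (hf.continuousOn_fderiv_of_isOpen hV (by simp)).clm_comp continuousOn_const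
  obtain ⟨B, u, hu, hξu, hB⟩ := exists_bound_near_compact hK isCompact_singleton hV hf' hKV
  have hun : u ∈ 𝓝 ξ := hu.mem_nhds (hξu rfl)
  have hslice : ∀ {G : Type u} [NormedAddCommGroup G] {g : P × E → G}, ContinuousOn g V →
      ∀ x ∈ u, ContinuousOn (fun p => g (p, x)) K := fun {G} _ {g} hg x hx =>
    hg.comp (by fun_prop) fun p hp => (hB p hp x hx).1
  have hfin : μ K < ⊤ := hK.measure_lt_top
  have : IsFiniteMeasure (μ.restrict K) := ⟨by simpa using hfin⟩
  refine hasFDerivAt_integral_of_dominated_of_fderiv_le (bound := fun _ => B) hun ?_ ?_ ?_ ?_ ?_ ?_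
    (F' := fun x p => (fderiv ℝ f (p, x)).comp (ContinuousLinearMap.inr ℝ P E))
  · filter_upwards [hun] with x hx
    exact (hslice hf.continuousOn x hx).aestronglyMeasurable hK.measurableSet
  · exact (hslice hf.continuousOn ξ (hξu rfl)).integrableOn_compact hK
  · exact (hslice hf' ξ (hξu rfl)).aestronglyMeasurable hK.measurableSet
  · filter_upwards [ae_restrict_mem hK.measurableSet] with p hp x hx using (hB p hp x hx).2
  · exact integrable_const B
  · filter_upwards [ae_restrict_mem hK.measurableSet] with p hp x hx
    have h1 : DifferentiableAt ℝ f (p, x) :=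
      (hf.contDiffAt (hV.mem_nhds (hB p hp x hx).1)).differentiableAt (by simp)
    exact h1.hasFDerivAt.comp x (hasFDerivAt_prodMk_right p x)

theorem contDiffAt_setIntegral_of_contDiffOn {E F : Type u} [NormedAddCommGroup E]
    [NormedSpace ℝ E] [NormedAddCommGroup F] [NormedSpace ℝ F]
    {K : Set P} (hK : IsCompact K) (μ : Measure P) [IsFiniteMeasureOnCompacts μ]
    {V : Set (P × E)} (hV : IsOpen V) {f : P × E → F} (hf : ContDiffOn ℝ ∞ f V) {ξ : E}
    (hKV : K ×ˢ {ξ} ⊆ V) :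
    ContDiffAt ℝ ∞ (fun x => ∫ p in K, f (p, x) ∂μ) ξ := by
  have hnear : ∀ {ξ : E}, K ×ˢ {ξ} ⊆ V → ∃ u : Set E, u ∈ 𝓝 ξ ∧ ∀ x ∈ u, K ×ˢ {x} ⊆ V := by
    intro ξ h
    obtain ⟨w, u, hw, hu, hKw, hCu, h⟩ := generalized_tube_lemma hK isCompact_singleton hV h
    refine ⟨u, hu.mem_nhds (hCu rfl), ?_⟩
    rintro x hx ⟨p, y⟩ ⟨hp, rfl⟩
    exact h (mk_mem_prod (hKw hp) hx)
  rw [contDiffAt_infty]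
  intro N
  -- The derivative is an integral of the same type with values in `E →L[ℝ] F`; `E` and `F` share a
  -- universe so that the induction hypothesis applies to this target.
  induction N generalizing F with
  | zero =>
    obtain ⟨u, hu, h⟩ := hnear hKV
    rw [Nat.cast_zero, contDiffAt_zero]
    exact ⟨u, hu, fun x hx =>
      (hasFDerivAt_setIntegral_of_contDiffOn hK μ hV hf (h x hx)).continuousAt.continuousWithinAt⟩
  | succ N ih =>
    obtain ⟨u, hu, h⟩ := hnear hKV
    rw [Nat.cast_add, Nat.cast_one, contDiffAt_succ_iff_hasFDerivAt]
    have hf' : ContDiffOn ℝ ∞ (fun y => (fderiv ℝ f y).comp (ContinuousLinearMap.inr ℝ P E)) V :=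
      (hf.fderiv_of_isOpen hV (by simp)).clm_comp contDiffOn_const
    exact ⟨_, ⟨u, hu, fun x hx => hasFDerivAt_setIntegral_of_contDiffOn hK μ hV hf (h x hx)⟩,
      ih hf'⟩

/-- The series is the integral of `f` against the finite measure `∑ c k • δ_{p k}` carried by `K`,
so smoothness of parametric integrals covers it without estimates on each derivative. -/
theorem contDiffAt_tsum_of_contDiffOn {E : Type} [NormedAddCommGroup E] [NormedSpace ℝ E]
    {K : Set P} (hK : IsCompact K) {p : ℕ → P} (hp : ∀ k, p k ∈ K) {c : ℕ → ℝ} (hc : ∀ k, 0 ≤ c k)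
    (hcs : Summable c) {V : Set (P × E)} (hV : IsOpen V) {f : P × E → ℝ} (hf : ContDiffOn ℝ ∞ f V)
    {ξ : E} (hKV : K ×ˢ {ξ} ⊆ V) :
    ContDiffAt ℝ ∞ (fun x => ∑' k, c k * f (p k, x)) ξ := by
  let μ : Measure P := Measure.sum fun k => ENNReal.ofReal (c k) • Measure.dirac (p k)
  have : IsFiniteMeasure μ := by
    refine ⟨?_⟩
    simp only [μ, Measure.sum_apply _ MeasurableSet.univ, Measure.smul_apply, measure_univ,
      smul_eq_mul, mul_one]
    rw [← ENNReal.ofReal_tsum_of_nonneg hc hcs]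
    exact ENNReal.ofReal_lt_top
  have hr : μ.restrict K = μ := by
    refine Measure.restrict_eq_self_of_ae_mem ?_
    rw [ae_iff, ← compl_def, Measure.sum_apply _ hK.measurableSet.compl]
    simp [hp, hK.measurableSet.compl]
  have hs : (fun x => ∑' k, c k * f (p k, x)) = fun x => ∫ q in K, f (q, x) ∂μ := by
    ext x
    rw [hr, integral_sum_dirac (by simp)]
    simp [ENNReal.toReal_ofReal (hc _)]
  rw [hs]
  exact contDiffAt_setIntegral_of_contDiffOn hK μ hV hf hKV

end Parametric

namespace Heisenberg

variable {n : ℕ}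

/-! ### Joint smoothness of the averaged solution in dilation parameters and argument -/

theorem inv_mul_eq_zero {ξ η : Heis n} : mul (inv ξ) η = 0 ↔ ξ = η := by
  constructor
  · intro h
    have h1 : -ξ.1 + η.1 = 0 := congrArg Prod.fst h
    have h2 : (mul (inv ξ) η).2 = 0 := congrArg Prod.snd h
    have h3 : ξ.1 = η.1 := neg_add_eq_zero.1 h1
    have h4 : (dotConj (-ξ.1) η.1).im = 0 := by
      rw [← h3]; simp [dotConj, Complex.mul_conj]
    simp only [mul, inv, h4] at h2
    exact Prod.ext h3 (by linarith)
  · rintro rfl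
    exact inv_mul_self ξ

/-- The average fundamental solution with dilated pole and argument, as a function of all data. -/
def avgFamily (η : Heis n) (x : (ℝ × ℝ) × Heis n) : ℝ := avgSol (dil x.1.1 η) (dil x.1.2 x.2)

/-- The parameters and arguments where `avgFamily η` is not singular. -/
def regularSet (η : Heis n) : Set ((ℝ × ℝ) × Heis n) :=
  {x | ∀ θ ∈ Set.Icc (0 : ℝ) (2 * Real.pi), rot θ (dil x.1.2 x.2) ≠ dil x.1.1 η}

theorem mem_regularSet_of_gauge_ne {η ξ : Heis n} {α β : ℝ}
    (h : gauge (dil β ξ) ≠ gauge (dil α η)) : ((α, β), ξ) ∈ regularSet η := by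
  intro θ _ h'
  apply h
  rw [← gauge_rot θ]
  exact congrArg gauge h'

theorem mem_regularSet_of_notMem_orbit {η ξ : Heis n} (h : ξ ∉ orbit η) :
    (((1 : ℝ), (1 : ℝ)), ξ) ∈ regularSet η := by
  intro θ _ h'
  simp only [dil_one] at h'
  exact h ⟨-θ, by simp only [← h', rot_rot]; simp [rot]⟩

theorem contDiff_conj : ContDiff ℝ ∞ (fun z : ℂ => (starRingEnd ℂ) z) :=
  Complex.conjCLE.contDiff

theorem contDiff_normSq {E : Type*} [NormedAddCommGroup E] [NormedSpace ℝ E] {f : E → Fin n → ℂ}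
    (hf : ContDiff ℝ ∞ f) : ContDiff ℝ ∞ fun x => normSq (f x) := by
  unfold normSq
  exact ContDiff.sum fun j _ => ((contDiff_pi.1 hf) j).norm_sq ℝ

theorem contDiff_dotConj {E : Type*} [NormedAddCommGroup E] [NormedSpace ℝ E] {f g : E → Fin n → ℂ}
    (hf : ContDiff ℝ ∞ f) (hg : ContDiff ℝ ∞ g) : ContDiff ℝ ∞ fun x => dotConj (f x) (g x) := by
  unfold dotConj
  exact ContDiff.sum fun j _ => ((contDiff_pi.1 hf) j).mul
    (contDiff_conj.comp ((contDiff_pi.1 hg) j))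

theorem contDiff_quartic {E : Type*} [NormedAddCommGroup E] [NormedSpace ℝ E] {f : E → Heis n}
    (hf : ContDiff ℝ ∞ f) : ContDiff ℝ ∞ fun x => quartic (f x) := by
  unfold quartic
  exact ((contDiff_normSq hf.fst).pow 2).add (hf.snd.pow 2)

theorem contDiff_mul {E : Type*} [NormedAddCommGroup E] [NormedSpace ℝ E] {f g : E → Heis n}
    (hf : ContDiff ℝ ∞ f) (hg : ContDiff ℝ ∞ g) : ContDiff ℝ ∞ fun x => mul (f x) (g x) := by
  unfold mul
  exact (hf.fst.add hg.fst).prodMk ((hf.snd.add hg.snd).add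
    (contDiff_const.mul (Complex.imCLM.contDiff.comp (contDiff_dotConj hf.fst hg.fst))))

theorem contDiff_inv {E : Type*} [NormedAddCommGroup E] [NormedSpace ℝ E] {f : E → Heis n}
    (hf : ContDiff ℝ ∞ f) : ContDiff ℝ ∞ fun x => inv (f x) := by
  unfold inv
  exact hf.fst.neg.prodMk hf.snd.neg

theorem contDiff_dil {E : Type*} [NormedAddCommGroup E] [NormedSpace ℝ E] {s : E → ℝ}
    {f : E → Heis n} (hs : ContDiff ℝ ∞ s) (hf : ContDiff ℝ ∞ f) :
    ContDiff ℝ ∞ fun x => dil (s x) (f x) := by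
  unfold dil
  exact (contDiff_pi.2 fun j => (Complex.ofRealCLM.contDiff.comp hs).mul
    ((contDiff_pi.1 hf.fst) j)).prodMk ((hs.pow 2).mul hf.snd)

theorem contDiff_rot {E : Type*} [NormedAddCommGroup E] [NormedSpace ℝ E] {s : E → ℝ}
    {f : E → Heis n} (hs : ContDiff ℝ ∞ s) (hf : ContDiff ℝ ∞ f) :
    ContDiff ℝ ∞ fun x => rot (s x) (f x) := by
  unfold rot
  exact ((Complex.contDiff_exp.comp ((Complex.ofRealCLM.contDiff.comp hs).mul
    contDiff_const)).smul hf.fst).prodMk hf.snd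

/-- The complement is the projection of a closed set along the compact interval of angles. -/
theorem isOpen_regularSet (η : Heis n) : IsOpen (regularSet η) := by
  rw [← isClosed_compl_iff]
  have : (regularSet η)ᶜ = Prod.snd '' {y : (Set.Icc (0 : ℝ) (2 * Real.pi)) × (ℝ × ℝ) × Heis n |
      rot y.1 (dil y.2.1.2 y.2.2) = dil y.2.1.1 η} := by
    ext x
    simp [regularSet, and_assoc]
  rw [this]
  refine isClosedMap_snd_of_compactSpace _ (isClosed_eq ?_ ?_)
  · have := (contDiff_rot (n := n) (contDiff_fst (E := ℝ) (F := (ℝ × ℝ) × Heis n))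
      (contDiff_dil contDiff_snd.fst.snd contDiff_snd.snd)).continuous
    exact this.comp (f := fun y : (Set.Icc (0 : ℝ) (2 * Real.pi)) × (ℝ × ℝ) × Heis n =>
      ((y.1 : ℝ), y.2)) (by fun_prop)
  · have := (contDiff_dil (n := n) (E := (ℝ × ℝ) × Heis n) (f := fun _ => η)
      contDiff_fst.fst contDiff_const).continuous
    exact this.comp (by fun_prop)

theorem contDiffOn_avgFamily (η : Heis n) : ContDiffOn ℝ ∞ (avgFamily η) (regularSet η) := by
  let q : ℝ × (ℝ × ℝ) × Heis n → ℝ := fun y =>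
    quartic (mul (inv (rot y.1 (dil y.2.1.2 y.2.2))) (dil y.2.1.1 η))
  have hq : ContDiff ℝ ∞ q :=
    contDiff_quartic (contDiff_mul (contDiff_inv (contDiff_rot contDiff_fst
      (contDiff_dil contDiff_snd.fst.snd contDiff_snd.snd)))
      (contDiff_dil contDiff_snd.fst.fst contDiff_const))
  have hV : IsOpen {y | q y ≠ 0} := isOpen_ne_fun hq.continuous continuous_const
  have hf : ContDiffOn ℝ ∞ (fun y => a0 n * q y ^ (-((n : ℝ) / 2))) {y | q y ≠ 0} :=
    contDiffOn_const.mul (hq.contDiffOn.rpow_const_of_ne fun y hy => hy)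
  intro x hx
  have hsub : Set.Icc (0 : ℝ) (2 * Real.pi) ×ˢ {x} ⊆ {y | q y ≠ 0} := by
    rintro ⟨θ, y⟩ ⟨hθ, rfl⟩ h0
    exact hx θ hθ (inv_mul_eq_zero.1 (quartic_eq_zero.1 h0))
  have h := contDiffAt_setIntegral_of_contDiffOn isCompact_Icc MeasureTheory.volume hV hf hsub
  have h2 : avgFamily η = fun x => (2 * Real.pi)⁻¹ * ∫ θ in Set.Icc (0 : ℝ) (2 * Real.pi),
      a0 n * q (θ, x) ^ (-((n : ℝ) / 2)) := by
    ext x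
    rw [avgFamily, avgSol, circAvg, intervalIntegral.integral_of_le (by positivity),
      ← MeasureTheory.integral_Icc_eq_integral_Ioc, smul_eq_mul]
    rfl
  rw [h2]
  exact (contDiffAt_const.mul h).contDiffWithinAt

theorem continuous_quartic : Continuous (quartic : Heis n → ℝ) :=
  (contDiff_quartic contDiff_id).continuous

theorem continuous_gauge : Continuous (gauge : Heis n → ℝ) :=
  continuous_quartic.rpow_const fun _ => Or.inr (by norm_num)

end Heisenberg
end

noncomputable section

namespace Heisenberg

open MeasureTheory

variable {n : ℕ}

/-! ### Left-invariant vector fields -/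

/-- The value at `ξ` of the left-invariant vector field with value `(c e_j, 0)` at the origin. -/
def leftField (j : Fin n) (c : ℂ) (ξ : Heis n) : Heis n :=
  (Pi.single j c, 2 * (ξ.1 j * (starRingEnd ℂ) c).im)

/-- The derivative along a left-invariant vector field. -/
def fld {F : Type*} [NormedAddCommGroup F] [NormedSpace ℝ F] (j : Fin n) (c : ℂ) (f : Heis n → F)
    (ξ : Heis n) : F := fderiv ℝ f ξ (leftField j c ξ)

theorem contDiff_leftField (j : Fin n) (c : ℂ) : ContDiff ℝ ∞ (leftField j c) := by
  unfold leftField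
  have : ContDiff ℝ ∞ fun ξ : Heis n => ξ.1 j * (starRingEnd ℂ) c :=
    ((contDiff_apply ℝ ℂ j).comp contDiff_fst).mul contDiff_const
  exact contDiff_const.prodMk (contDiff_const.mul (Complex.imCLM.contDiff.comp this))

theorem contDiff_fld {F : Type*} [NormedAddCommGroup F] [NormedSpace ℝ F] (j : Fin n) (c : ℂ)
    {f : Heis n → F} (hf : ContDiff ℝ ∞ f) : ContDiff ℝ ∞ (fld j c f) := by
  unfold fld
  exact (hf.fderiv_right (by simp)).clm_apply (contDiff_leftField j c)

theorem tsupport_fld_subset {F : Type*} [NormedAddCommGroup F] [NormedSpace ℝ F] (j : Fin n) (c : ℂ)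
    (f : Heis n → F) : tsupport (fld j c f) ⊆ tsupport f := by
  refine closure_minimal (fun ξ hξ => ?_) (isClosed_tsupport f)
  by_contra h
  exact hξ (by simp [fld, fderiv_of_notMem_tsupport ℝ h])

theorem hasCompactSupport_fld {F : Type*} [NormedAddCommGroup F] [NormedSpace ℝ F] (j : Fin n)
    (c : ℂ) {f : Heis n → F} (hf : HasCompactSupport f) : HasCompactSupport (fld j c f) :=
  hf.of_isClosed_subset (isClosed_tsupport _) (tsupport_fld_subset j c f)

theorem leftField_eq (j : Fin n) (c : ℂ) (ξ : Heis n) : leftField j c ξ =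
    ((Pi.single j c, 0) : Heis n) + (2 * (ξ.1 j * (starRingEnd ℂ) c).im) • ((0, 1) : Heis n) := by
  simp [leftField]

theorem Z_eq (j : Fin n) {f : Heis n → ℂ} :
    Z j f = fun ξ => (1 / 2) * (fld j 1 f ξ - Complex.I * fld j Complex.I f ξ) := by
  ext ξ
  simp only [Z, dz, T, fld, leftField_eq, map_add, map_smul, Complex.real_smul]
  have h : (starRingEnd ℂ) (ξ.1 j) = (ξ.1 j).re - (ξ.1 j).im * Complex.I := by
    apply Complex.ext <;> simp
  rw [h]
  simp
  linear_combination (-((ξ.1 j).im : ℂ) * fderiv ℝ f ξ (0, 1)) * Complex.I_sq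

theorem Zbar_eq (j : Fin n) {f : Heis n → ℂ} :
    Zbar j f = fun ξ => (1 / 2) * (fld j 1 f ξ + Complex.I * fld j Complex.I f ξ) := by
  ext ξ
  simp only [Zbar, dzbar, T, fld, leftField_eq, map_add, map_smul, Complex.real_smul]
  simp
  linear_combination (-((ξ.1 j).im : ℂ) * fderiv ℝ f ξ (0, 1)) * Complex.I_sq +
    Complex.I * fderiv ℝ f ξ (0, 1) * Complex.re_add_im (ξ.1 j)

theorem fld_const_mul_add (j : Fin n) (c a b : ℂ) {f g : Heis n → ℂ} (hf : ContDiff ℝ ∞ f)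
    (hg : ContDiff ℝ ∞ g) (ξ : Heis n) :
    fld j c (fun ξ => a * (f ξ + b * g ξ)) ξ = a * (fld j c f ξ + b * fld j c g ξ) := by
  have h1 := (hf.differentiable (by simp) ξ).hasFDerivAt
  have h2 := (hg.differentiable (by simp) ξ).hasFDerivAt
  have h3 : HasFDerivAt (fun ξ => a * (f ξ + b * g ξ))
    (a • (fderiv ℝ f ξ + b • fderiv ℝ g ξ)) ξ := (h1.add (h2.const_mul b)).const_mul a
  rw [fld, h3.fderiv]
  rfl

/-- With `X = fld j 1` and `Y = fld j I`, the mixed terms of `Z̄Z` and `ZZ̄` cancel, leaving a sum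
of squares of real fields. -/
theorem L0_eq {f : Heis n → ℂ} (hf : ContDiff ℝ ∞ f) (ξ : Heis n) : L0 f ξ =
    -(1 / 4) * ∑ j, (fld j 1 (fld j 1 f) ξ + fld j Complex.I (fld j Complex.I f) ξ) := by
  rw [L0, subLaplacian, Finset.mul_sum]
  congr 1
  refine Finset.sum_congr rfl fun j _ => ?_
  have h1 := contDiff_fld j 1 hf
  have h2 := contDiff_fld j Complex.I hf
  have hm : (fun ξ => (1 / 2 : ℂ) * (fld j 1 f ξ - Complex.I * fld j Complex.I f ξ)) =
      fun ξ => (1 / 2 : ℂ) * (fld j 1 f ξ + (-Complex.I) * fld j Complex.I f ξ) := by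
    ext ξ; ring
  rw [Z_eq (f := f), Zbar_eq (f := f), hm, Z_eq, Zbar_eq]
  simp only [fld_const_mul_add j _ _ _ h1 h2]
  linear_combination (-(1 : ℂ) * fld j Complex.I (fld j Complex.I f) ξ) * Complex.I_sq

theorem continuous_L0 {f : Heis n → ℂ} (hf : ContDiff ℝ ∞ f) : Continuous (L0 f) := by
  have : L0 f = fun ξ => -(1 / 4) *
      ∑ j, (fld j 1 (fld j 1 f) ξ + fld j Complex.I (fld j Complex.I f) ξ) := funext (L0_eq hf)
  rw [this]
  exact continuous_const.mul (continuous_finsetSum _ fun j _ =>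
    ((contDiff_fld j 1 (contDiff_fld j 1 hf)).continuous.add
    (contDiff_fld j _ (contDiff_fld j _ hf)).continuous))

theorem L0_eq_zero_of_notMem_tsupport {f : Heis n → ℂ} (hf : ContDiff ℝ ∞ f) {ξ : Heis n}
    (h : ξ ∉ tsupport f) : L0 f ξ = 0 := by
  have h0 : ∀ (j : Fin n) (c : ℂ), fld j c (fld j c f) ξ = 0 := fun j c =>
    image_eq_zero_of_notMem_tsupport fun h' =>
      h (tsupport_fld_subset j c f (tsupport_fld_subset j c _ h'))
  simp [L0_eq hf, h0]

theorem hasCompactSupport_L0 {f : Heis n → ℂ} (hf : ContDiff ℝ ∞ f) (hc : HasCompactSupport f) :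
    HasCompactSupport (L0 f) :=
  HasCompactSupport.intro hc fun _ h => L0_eq_zero_of_notMem_tsupport hf h

/-! ### Left invariance -/

theorem fld_comp_mul {F : Type*} [NormedAddCommGroup F] [NormedSpace ℝ F] (j : Fin n) (c : ℂ)
    {f : Heis n → F} (hf : ContDiff ℝ ∞ f) (η : Heis n) :
    fld j c (fun ξ => f (mul η ξ)) = fun ξ => fld j c f (mul η ξ) := by
  ext ξ
  have hd : DifferentiableAt ℝ (fun ξ => mul η ξ) ξ :=
    (contDiff_mul contDiff_const contDiff_id).differentiable (by simp) ξ
  have hline : HasDerivAt (fun s : ℝ => mul η (ξ + s • leftField j c ξ))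
      (leftField j c (mul η ξ)) 0 := by
    -- Left translation is affine and carries this straight line to the corresponding line at the
    -- translated point, so invariance can be read off from a one-variable derivative.
    have h : ∀ s : ℝ, mul η (ξ + s • leftField j c ξ) = mul η ξ + s • leftField j c (mul η ξ) := by
      intro s
      have : ∀ (a b d : Fin n → ℂ), dotConj a (b + s • d) = dotConj a b + s * dotConj a d := by
        intro a b d
        simp only [dotConj, Finset.mul_sum, ← Finset.sum_add_distrib]
        refine Finset.sum_congr rfl fun i _ => ?_
        simp; ring
      have h2 : dotConj η.1 (Pi.single j c) = η.1 j * (starRingEnd ℂ) c := by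
        rw [dotConj, Finset.sum_eq_single j]
        · simp
        · intro i _ hi; simp [hi]
        · simp
      refine Prod.ext ?_ ?_
      · simp [mul, leftField, add_assoc]
      · simp only [mul, leftField, Prod.fst_add, Prod.smul_fst, Prod.snd_add, Prod.smul_snd, this,
          h2, Complex.add_im, smul_eq_mul, Complex.im_ofReal_mul, Pi.add_apply, add_mul]
        ring
    simp only [h]
    simpa using ((hasDerivAt_id (0 : ℝ)).smul_const (leftField j c (mul η ξ))).const_add (mul η ξ)
  have hl : HasDerivAt (fun s : ℝ => ξ + s • leftField j c ξ) (leftField j c ξ) 0 := by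
    simpa using ((hasDerivAt_id (0 : ℝ)).smul_const (leftField j c ξ)).const_add ξ
  have h0 : ξ + (0 : ℝ) • leftField j c ξ = ξ := by simp
  have h1 : HasDerivAt (fun s : ℝ => mul η (ξ + s • leftField j c ξ))
      (fderiv ℝ (fun ξ => mul η ξ) ξ (leftField j c ξ)) 0 :=
    HasFDerivAt.comp_hasDerivAt_of_eq (0 : ℝ) hd.hasFDerivAt hl h0.symm
  rw [fld, fld, show (fun ξ => f (mul η ξ)) = f ∘ fun ξ => mul η ξ from rfl,
    fderiv_comp ξ (hf.differentiable (by simp) _) hd, ContinuousLinearMap.comp_apply,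
    h1.unique hline]

theorem L0_comp_mul {f : Heis n → ℂ} (hf : ContDiff ℝ ∞ f) (η ξ : Heis n) :
    L0 (fun ξ => f (mul η ξ)) ξ = L0 f (mul η ξ) := by
  have h : ContDiff ℝ ∞ fun ξ => f (mul η ξ) := hf.comp (contDiff_mul contDiff_const contDiff_id)
  rw [L0_eq hf, L0_eq h]
  simp only [fld_comp_mul _ _ hf, fld_comp_mul _ _ (contDiff_fld _ _ hf)]

/-! ### Integration by parts -/

theorem hasCompactSupport_smul (u : Heis n → ℝ) {f : Heis n → ℂ} (hc : HasCompactSupport f) :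
    HasCompactSupport fun ξ => u ξ • f ξ :=
  HasCompactSupport.intro hc fun ξ h => by rw [image_eq_zero_of_notMem_tsupport h, smul_zero]

instance isAddHaarMeasure_volume : (volume : Measure (Heis n)).IsAddHaarMeasure := by
  have : (volume : Measure (Fin n → ℂ)).IsAddHaarMeasure := by
    rw [volume_pi]; infer_instance
  exact Measure.prod.instIsAddHaarMeasure _ _

/-- The field is divergence free: it is a constant vector plus a multiple of `∂_t` whose coefficient
does not depend on `t`. -/
theorem integral_fld_eq_zero (j : Fin n) (c : ℂ) {f : Heis n → ℂ} (hf : ContDiff ℝ ∞ f)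
    (hc : HasCompactSupport f) : ∫ ξ, fld j c f ξ = 0 := by
  have key : ∀ (u : Heis n → ℝ) (v : Heis n), ContDiff ℝ ∞ u → (∀ ξ, fderiv ℝ u ξ v = 0) →
      ∫ ξ, u ξ • fderiv ℝ f ξ v = 0 ∧ Integrable fun ξ => u ξ • fderiv ℝ f ξ v := by
    intro u v hu h0
    have hcf : Continuous fun ξ => fderiv ℝ f ξ v :=
      ((hf.continuous_fderiv (by simp)).clm_apply continuous_const)
    have hcs : HasCompactSupport fun ξ => fderiv ℝ f ξ v := by
      refine HasCompactSupport.intro hc fun ξ hξ => ?_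
      simp [fderiv_of_notMem_tsupport ℝ hξ]
    have hi : Integrable fun ξ => u ξ • fderiv ℝ f ξ v :=
      (hu.continuous.smul hcf).integrable_of_hasCompactSupport (hasCompactSupport_smul u hcs)
    refine ⟨?_, hi⟩
    have := integral_smul_fderiv_eq_neg_fderiv_smul_of_integrable (μ := volume) (f := u) (g := f)
      (v := v) (by simp [h0]) hi
      ((hu.continuous.smul hf.continuous).integrable_of_hasCompactSupport (hasCompactSupport_smul u hc))
      (fun x _ => hu.differentiable (by simp) x) (fun x _ => hf.differentiable (by simp) x)
    rw [this]
    simp [h0]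
  have hu : ContDiff ℝ ∞ fun ξ : Heis n => 2 * (ξ.1 j * (starRingEnd ℂ) c).im :=
    (contDiff_leftField j c).snd
  have h1 := key (fun _ => 1) (Pi.single j c, 0) contDiff_const (by simp)
  have h2 := key _ ((0, 1) : Heis n) hu (by
    intro ξ
    have hl : HasDerivAt (fun s : ℝ => ξ + s • ((0, 1) : Heis n)) ((0, 1) : Heis n) 0 := by
      simpa using ((hasDerivAt_id (0 : ℝ)).smul_const ((0, 1) : Heis n)).const_add ξ
    have h := HasFDerivAt.comp_hasDerivAt_of_eq (0 : ℝ)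
      (hu.differentiable (by simp) ξ).hasFDerivAt hl (by simp)
    refine h.unique ?_
    simpa [Function.comp_def] using hasDerivAt_const (0 : ℝ) _)
  simp only [one_smul] at h1
  simp only [fld, leftField_eq, map_add, map_smul]
  rw [integral_add h1.2 h2.2, h1.1, h2.1, add_zero]

theorem fld_smul (j : Fin n) (c : ℂ) {u : Heis n → ℝ} {f : Heis n → ℂ} (hu : ContDiff ℝ ∞ u)
    (hf : ContDiff ℝ ∞ f) (ξ : Heis n) :
    fld j c (fun ξ => u ξ • f ξ) ξ = u ξ • fld j c f ξ + fld j c u ξ • f ξ := by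
  rw [fld, fderiv_fun_smul (hu.differentiable (by simp) ξ) (hf.differentiable (by simp) ξ)]
  rfl

theorem integrable_smul {u : Heis n → ℝ} {f : Heis n → ℂ} (hu : ContDiff ℝ ∞ u)
    (hf : ContDiff ℝ ∞ f) (hc : HasCompactSupport f) : Integrable fun ξ => u ξ • f ξ :=
  (hu.continuous.smul hf.continuous).integrable_of_hasCompactSupport (hasCompactSupport_smul u hc)

theorem integral_smul_fld (j : Fin n) (c : ℂ) {u : Heis n → ℝ} {f : Heis n → ℂ}
    (hu : ContDiff ℝ ∞ u) (hf : ContDiff ℝ ∞ f) (hc : HasCompactSupport f) :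
    ∫ ξ, u ξ • fld j c f ξ = -∫ ξ, fld j c u ξ • f ξ := by
  have hs : ContDiff ℝ ∞ fun ξ => u ξ • f ξ := hu.smul hf
  have hcs : HasCompactSupport fun ξ => u ξ • f ξ := (hasCompactSupport_smul u hc)
  have ha := integral_fld_eq_zero j c hs hcs
  simp only [fld_smul j c hu hf] at ha
  rw [integral_add (integrable_smul hu (contDiff_fld j c hf) (hasCompactSupport_fld j c hc))
    (integrable_smul (contDiff_fld j c hu) hf hc)] at ha
  exact eq_neg_of_add_eq_zero_left ha

theorem integral_smul_fld_fld (j : Fin n) (c : ℂ) {u : Heis n → ℝ} {f : Heis n → ℂ}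
    (hu : ContDiff ℝ ∞ u) (hf : ContDiff ℝ ∞ f) (hc : HasCompactSupport f) :
    ∫ ξ, u ξ • fld j c (fld j c f) ξ = ∫ ξ, fld j c (fld j c u) ξ • f ξ := by
  rw [integral_smul_fld j c hu (contDiff_fld j c hf) (hasCompactSupport_fld j c hc),
    integral_smul_fld j c (contDiff_fld j c hu) hf hc, neg_neg]

theorem integral_smul_L0 {u : Heis n → ℝ} {f : Heis n → ℂ}
    (hu : ContDiff ℝ ∞ u) (hf : ContDiff ℝ ∞ f) (hc : HasCompactSupport f) :
    ∫ ξ, u ξ • L0 f ξ = ∫ ξ, (-(1 / 4) * ∑ j, (fld j 1 (fld j 1 u) ξ +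
      fld j Complex.I (fld j Complex.I u) ξ)) • f ξ := by
  have hi : ∀ (j : Fin n) (c : ℂ), Integrable fun ξ => u ξ • fld j c (fld j c f) ξ := fun j c =>
    integrable_smul hu (contDiff_fld j c (contDiff_fld j c hf))
      (hasCompactSupport_fld j c (hasCompactSupport_fld j c hc))
  have hi' : ∀ (j : Fin n) (c : ℂ), Integrable fun ξ => fld j c (fld j c u) ξ • f ξ := fun j c =>
    integrable_smul (contDiff_fld j c (contDiff_fld j c hu)) hf hc
  have h1 : ∀ ξ, u ξ • L0 f ξ = (-(1 / 4) : ℂ) * ∑ j, (u ξ • fld j 1 (fld j 1 f) ξ +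
      u ξ • fld j Complex.I (fld j Complex.I f) ξ) := by
    intro ξ
    rw [L0_eq hf, Finset.mul_sum, Finset.smul_sum, Finset.mul_sum]
    refine Finset.sum_congr rfl fun j _ => ?_
    simp only [Complex.real_smul]; ring
  have h2 : ∀ ξ, (-(1 / 4) * ∑ j, (fld j 1 (fld j 1 u) ξ +
      fld j Complex.I (fld j Complex.I u) ξ)) • f ξ = (-(1 / 4) : ℂ) * ∑ j,
      (fld j 1 (fld j 1 u) ξ • f ξ + fld j Complex.I (fld j Complex.I u) ξ • f ξ) := by
    intro ξ
    simp only [Complex.real_smul]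
    push_cast
    rw [_root_.mul_assoc, Finset.sum_mul]
    simp only [add_mul]
  simp only [h1, h2]
  rw [integral_const_mul, integral_const_mul, integral_finsetSum, integral_finsetSum]
  · congr 1
    refine Finset.sum_congr rfl fun j _ => ?_
    rw [integral_add (hi j _) (hi j _), integral_add (hi' j _) (hi' j _),
      integral_smul_fld_fld j _ hu hf hc, integral_smul_fld_fld j _ hu hf hc]
  · exact fun j _ => (hi' j _).add (hi' j _)
  · exact fun j _ => (hi j _).add (hi j _)

end Heisenberg
end

noncomputable section

namespace Heisenberg

open MeasureTheory

variable {n : ℕ}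

/-! ### The regularized fundamental solution -/

/-- `f` is differentiable with derivative `g` along the field `leftField j c`. -/
def HasFld (j : Fin n) (c : ℂ) (f g : Heis n → ℝ) : Prop :=
  ∀ ξ, ∃ f' : Heis n →L[ℝ] ℝ, HasFDerivAt f f' ξ ∧ f' (leftField j c ξ) = g ξ

namespace HasFld

variable {j : Fin n} {c : ℂ} {f f₁ f₂ g g₁ g₂ : Heis n → ℝ}

theorem fld_eq (h : HasFld j c f g) : fld j c f = g := by
  ext ξ
  obtain ⟨f', h1, h2⟩ := h ξ
  rw [fld, h1.fderiv, h2]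

theorem add (h₁ : HasFld j c f₁ g₁) (h₂ : HasFld j c f₂ g₂) :
    HasFld j c (fun ξ => f₁ ξ + f₂ ξ) (fun ξ => g₁ ξ + g₂ ξ) := by
  intro ξ
  obtain ⟨a, ha, ha'⟩ := h₁ ξ
  obtain ⟨b, hb, hb'⟩ := h₂ ξ
  exact ⟨a + b, ha.add hb, by simp [ha', hb']⟩

theorem mul (h₁ : HasFld j c f₁ g₁) (h₂ : HasFld j c f₂ g₂) :
    HasFld j c (fun ξ => f₁ ξ * f₂ ξ) (fun ξ => f₁ ξ * g₂ ξ + g₁ ξ * f₂ ξ) := by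
  intro ξ
  obtain ⟨a, ha, ha'⟩ := h₁ ξ
  obtain ⟨b, hb, hb'⟩ := h₂ ξ
  exact ⟨_, ha.mul hb, by simp [ha', hb']; ring⟩

theorem const (j : Fin n) (c : ℂ) (a : ℝ) : HasFld j c (fun _ => a) (fun _ => 0) := fun ξ =>
  ⟨0, hasFDerivAt_const a ξ, rfl⟩

theorem const_mul (a : ℝ) (h : HasFld j c f g) : HasFld j c (fun ξ => a * f ξ) (fun ξ => a * g ξ) := by
  simpa using (const j c a).mul h

theorem rpow (h : HasFld j c f g) (hf : ∀ ξ, 0 < f ξ) (p : ℝ) :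
    HasFld j c (fun ξ => f ξ ^ p) (fun ξ => p * f ξ ^ (p - 1) * g ξ) := by
  intro ξ
  obtain ⟨a, ha, ha'⟩ := h ξ
  exact ⟨_, ha.rpow_const (Or.inl (hf ξ).ne'), by simp [ha']⟩

theorem snd (j : Fin n) (c : ℂ) :
    HasFld j c (fun ξ => ξ.2) (fun ξ => 2 * (ξ.1 j * (starRingEnd ℂ) c).im) := fun _ =>
  ⟨ContinuousLinearMap.snd ℝ _ _, hasFDerivAt_snd, rfl⟩

theorem coord (j : Fin n) (c : ℂ) (a : ℂ →L[ℝ] ℝ) :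
    HasFld j c (fun ξ => a (ξ.1 j)) (fun _ => a c) := fun ξ =>
  ⟨a ∘L (ContinuousLinearMap.proj (R := ℝ) (φ := fun _ : Fin n => ℂ) j) ∘L
    (ContinuousLinearMap.fst ℝ (Fin n → ℂ) ℝ),
    (a ∘L (ContinuousLinearMap.proj (R := ℝ) (φ := fun _ : Fin n => ℂ) j) ∘L
    (ContinuousLinearMap.fst ℝ (Fin n → ℂ) ℝ)).hasFDerivAt, by simp [leftField]⟩

theorem normSq (j : Fin n) (c : ℂ) :
    HasFld j c (fun ξ => normSq ξ.1) (fun ξ => 2 * (ξ.1 j * (starRingEnd ℂ) c).re) := by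
  intro ξ
  have h : ∀ i : Fin n, HasFDerivAt (fun ξ : Heis n => ‖ξ.1 i‖ ^ 2)
      (2 • (innerSL ℝ (ξ.1 i)).comp ((ContinuousLinearMap.proj i) ∘L
        (ContinuousLinearMap.fst ℝ (Fin n → ℂ) ℝ))) ξ := fun i =>
    HasFDerivAt.norm_sq (ContinuousLinearMap.hasFDerivAt
      ((ContinuousLinearMap.proj (R := ℝ) (φ := fun _ : Fin n => ℂ) i) ∘L
      (ContinuousLinearMap.fst ℝ (Fin n → ℂ) ℝ)))
  refine ⟨_, HasFDerivAt.fun_sum fun i _ => h i, ?_⟩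
  rw [_root_.sum_apply, Finset.sum_eq_single j]
  · simp [leftField, Complex.inner]
    ring
  · intro i _ hi
    simp [leftField, hi]
  · simp

end HasFld

/-- The regularization `(|z|² + ε)² + t²` of the fourth power of the gauge. -/
def regQuartic (ε : ℝ) (ξ : Heis n) : ℝ := (normSq ξ.1 + ε) ^ 2 + ξ.2 ^ 2

theorem regQuartic_zero (ξ : Heis n) : regQuartic 0 ξ = quartic ξ := by
  simp [regQuartic, quartic]

theorem regQuartic_pos {ε : ℝ} (hε : 0 < ε) (ξ : Heis n) : 0 < regQuartic ε ξ := by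
  have := normSq_nonneg ξ.1
  unfold regQuartic; positivity

theorem contDiff_regQuartic (ε : ℝ) : ContDiff ℝ ∞ (regQuartic ε : Heis n → ℝ) := by
  unfold regQuartic
  exact (((contDiff_normSq contDiff_fst).add contDiff_const).pow 2).add (contDiff_snd.pow 2)

theorem hasFld_regQuartic (ε : ℝ) (j : Fin n) (c : ℂ) : HasFld j c (regQuartic ε) (fun ξ =>
    4 * ((normSq ξ.1 + ε) * (ξ.1 j * (starRingEnd ℂ) c).re +
      ξ.2 * (ξ.1 j * (starRingEnd ℂ) c).im)) := by
  have hs := (HasFld.normSq j c).add (HasFld.const j c ε)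
  have h := (hs.mul hs).add ((HasFld.snd j c).mul (HasFld.snd j c))
  convert! h using 1
  · ext ξ; simp only [regQuartic]; ring
  · ext ξ; ring

theorem hasFld_fld_regQuartic (ε : ℝ) (j : Fin n) {c : ℂ} (hc : ‖c‖ = 1) : HasFld j c (fun ξ =>
    4 * ((normSq ξ.1 + ε) * (ξ.1 j * (starRingEnd ℂ) c).re +
      ξ.2 * (ξ.1 j * (starRingEnd ℂ) c).im)) (fun ξ => 4 * (2 * ‖ξ.1 j‖ ^ 2 + (normSq ξ.1 + ε))) := by
  have hcc : c * (starRingEnd ℂ) c = 1 := by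
    rw [Complex.mul_conj, Complex.normSq_eq_norm_sq, hc]; simp
  have hs := (HasFld.normSq j c).add (HasFld.const j c ε)
  have hre := congrArg Complex.re hcc
  simp only [Complex.mul_re, Complex.conj_re, Complex.conj_im, Complex.one_re] at hre
  have hr : HasFld j c (fun ξ => (ξ.1 j * (starRingEnd ℂ) c).re) (fun _ => 1) := by
    convert! HasFld.coord j c
      (Complex.reCLM ∘L (ContinuousLinearMap.mul ℝ ℂ).flip ((starRingEnd ℂ) c)) using 1
    ext ξ
    simp
    linarith
  have hi : HasFld j c (fun ξ => (ξ.1 j * (starRingEnd ℂ) c).im) (fun _ => 0) := by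
    convert! HasFld.coord j c
      (Complex.imCLM ∘L (ContinuousLinearMap.mul ℝ ℂ).flip ((starRingEnd ℂ) c)) using 1
    ext ξ
    simp
    ring
  have h := ((hs.mul hr).add ((HasFld.snd j c).mul hi)).const_mul 4
  convert! h using 1
  ext ξ
  have : ‖ξ.1 j‖ ^ 2 = ‖ξ.1 j * (starRingEnd ℂ) c‖ ^ 2 := by
    rw [norm_mul, Complex.norm_conj, hc, mul_one]
  rw [this, ← Complex.normSq_eq_norm_sq, Complex.normSq_apply]
  ring

/-- The regularized fundamental solution, without normalization. -/
def regSol (ε : ℝ) (ξ : Heis n) : ℝ := regQuartic ε ξ ^ (-((n : ℝ) / 2))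

theorem contDiff_regSol {ε : ℝ} (hε : 0 < ε) : ContDiff ℝ ∞ (regSol ε : Heis n → ℝ) :=
  (contDiff_regQuartic ε).rpow_const_of_ne fun ξ => (regQuartic_pos hε ξ).ne'

theorem fld_fld_regSol {ε : ℝ} (hε : 0 < ε) (j : Fin n) {c : ℂ} (hc : ‖c‖ = 1) (ξ : Heis n) :
    fld j c (fld j c (regSol ε)) ξ =
      -((n : ℝ) / 2) * regQuartic ε ξ ^ (-((n : ℝ) / 2) - 1) *
        (4 * (2 * ‖ξ.1 j‖ ^ 2 + (normSq ξ.1 + ε))) +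
      -((n : ℝ) / 2) * (-((n : ℝ) / 2) - 1) * regQuartic ε ξ ^ (-((n : ℝ) / 2) - 1 - 1) *
        (16 * ((normSq ξ.1 + ε) * (ξ.1 j * (starRingEnd ℂ) c).re +
          ξ.2 * (ξ.1 j * (starRingEnd ℂ) c).im) ^ 2) := by
  have h1 := (hasFld_regQuartic ε j c).rpow (regQuartic_pos hε) (-((n : ℝ) / 2))
  have h2 := ((((hasFld_regQuartic ε j c).rpow (regQuartic_pos hε) (-((n : ℝ) / 2) - 1)).const_mul
    (-((n : ℝ) / 2))).mul (hasFld_fld_regQuartic ε j hc)).fld_eq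
  have h3 : fld j c (regSol ε) = _ := h1.fld_eq
  rw [h3, h2]
  ring

/-- With `s = |z|² + ε` and `ρ = s² + t²`, the squared first derivatives for `c = 1` and `c = I` add
up to a multiple of `ρ |z_j|²`. Summing over `j` leaves `4n²(|z|² - s) = -4n²ε` as the coefficient
of `ρ ^ (-n/2 - 1)`. -/
theorem subLaplacian_regSol {ε : ℝ} (hε : 0 < ε) (ξ : Heis n) :
    -(1 / 4) * ∑ j, (fld j 1 (fld j 1 (regSol ε)) ξ +
      fld j Complex.I (fld j Complex.I (regSol ε)) ξ) =
      (n : ℝ) ^ 2 * (ε * regQuartic ε ξ ^ (-((n : ℝ) / 2) - 1)) := by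
  have hρ := regQuartic_pos hε ξ
  have hp : regQuartic ε ξ ^ (-((n : ℝ) / 2) - 1) =
      regQuartic ε ξ ^ (-((n : ℝ) / 2) - 1 - 1) * regQuartic ε ξ := by
    rw [Real.rpow_sub_one hρ.ne' (_ - 1), div_mul_cancel₀ _ hρ.ne']
  have h : ∀ j, fld j 1 (fld j 1 (regSol ε)) ξ + fld j Complex.I (fld j Complex.I (regSol ε)) ξ =
      regQuartic ε ξ ^ (-((n : ℝ) / 2) - 1) *
        ((4 * (n : ℝ) ^ 2) * ‖ξ.1 j‖ ^ 2 - 4 * n * (normSq ξ.1 + ε)) := by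
    intro j
    rw [fld_fld_regSol hε j (by simp), fld_fld_regSol hε j (by simp), hp]
    have : ‖ξ.1 j‖ ^ 2 = (ξ.1 j).re ^ 2 + (ξ.1 j).im ^ 2 := by
      rw [← Complex.normSq_eq_norm_sq, Complex.normSq_apply]; ring
    rw [this]
    simp only [map_one, mul_one, Complex.conj_I, mul_neg, Complex.neg_re, Complex.neg_im,
      Complex.mul_re, Complex.mul_im, Complex.I_re, Complex.I_im, regQuartic]
    ring
  simp only [h, ← Finset.mul_sum, Finset.sum_sub_distrib]
  simp only [Finset.sum_const, Finset.card_univ, Fintype.card_fin, nsmul_eq_mul]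
  rw [← normSq]
  ring

theorem integral_regSol_smul_L0 {ε : ℝ} (hε : 0 < ε) {f : Heis n → ℂ} (hf : ContDiff ℝ ∞ f)
    (hc : HasCompactSupport f) : ∫ ξ, regSol ε ξ • L0 f ξ =
      (n : ℝ) ^ 2 • ∫ ξ, (ε * regQuartic ε ξ ^ (-((n : ℝ) / 2) - 1)) • f ξ := by
  rw [integral_smul_L0 (contDiff_regSol hε) hf hc, ← integral_smul]
  simp only [subLaplacian_regSol hε, mul_smul]

/-! ### Change of variables -/

theorem map_dil_volume {r : ℝ} (hr : 0 < r) :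
    (volume : Measure (Heis n)).map (dil r) = ENNReal.ofReal ((r ^ (2 * n + 2))⁻¹) • volume := by
  have h : (dil r : Heis n → Heis n) = Prod.map (fun z => r • z) (fun t => r ^ 2 • t) := by
    ext ξ <;> simp [dil]
  have h1 : (volume : Measure (Fin n → ℂ)).IsAddHaarMeasure := by
    rw [volume_pi]; infer_instance
  have hfin : Module.finrank ℝ (Fin n → ℂ) = 2 * n := by
    simp [Module.finrank_pi_fintype, mul_comm]
  rw [h, Measure.volume_eq_prod, ← Measure.map_prod_map _ _ (by fun_prop) (by fun_prop),
    Measure.map_addHaar_smul volume hr.ne', Measure.map_addHaar_smul volume (by positivity), hfin,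
    Measure.prod_smul_left, Measure.prod_smul_right, smul_smul, ← ENNReal.ofReal_mul (abs_nonneg _)]
  congr 2
  rw [Module.finrank_self, ← abs_mul, abs_of_pos (by positivity), pow_add, mul_inv, pow_one]

theorem continuous_dil (r : ℝ) : Continuous (dil r : Heis n → Heis n) :=
  (contDiff_dil contDiff_const contDiff_id).continuous

theorem integral_comp_dil {E : Type*} [NormedAddCommGroup E] [NormedSpace ℝ E] {r : ℝ} (hr : 0 < r)
    {f : Heis n → E} (hf : AEStronglyMeasurable f) :
    ∫ ξ, f ξ = r ^ (2 * n + 2) • ∫ ξ, f (dil r ξ) := by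
  have hm : AEStronglyMeasurable f ((volume : Measure (Heis n)).map (dil r)) := by
    rw [map_dil_volume hr]; exact hf.smul_measure _
  rw [← integral_map (continuous_dil r).aemeasurable hm, map_dil_volume hr, integral_smul_measure,
    ENNReal.toReal_ofReal (by positivity), smul_smul, mul_inv_cancel₀ (by positivity), one_smul]

/-- Left translation is a translation in `z` followed on each fibre by a translation in `t`. -/
theorem measurePreserving_mul_left (η : Heis n) :
    MeasurePreserving (fun ξ : Heis n => mul η ξ) := by
  have h1 : (volume : Measure (Fin n → ℂ)).IsAddHaarMeasure := by
    rw [volume_pi]; infer_instance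
  rw [Measure.volume_eq_prod]
  refine (measurePreserving_add_left volume η.1).skew_product
    (g := fun z t => η.2 + t + 2 * (dotConj η.1 z).im) ?_ ?_
  · exact (contDiff_mul (f := fun _ : Heis n => η) contDiff_const
      contDiff_id).continuous.snd.measurable
  · refine Filter.Eventually.of_forall fun z => ?_
    have : (fun t => η.2 + t + 2 * (dotConj η.1 z).im) =
        fun t => (η.2 + 2 * (dotConj η.1 z).im) + t := by ext t; ring
    rw [this]
    exact (measurePreserving_add_left volume _).map_eq

end Heisenberg
end

noncomputable section

/-! ### Integrals by subordination to exponentials -/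

section Subordination

open MeasureTheory Set

theorem lintegral_rpow_mul_exp_neg_mul_Ioi {a r : ℝ} (ha : 0 < a) (hr : 0 < r) :
    ∫⁻ u in Ioi (0 : ℝ), ENNReal.ofReal (u ^ (a - 1) * Real.exp (-(r * u))) =
      ENNReal.ofReal (r ^ (-a) * Real.Gamma a) := by
  have h := Real.integral_rpow_mul_exp_neg_mul_Ioi ha hr
  have hpos : 0 < (1 / r) ^ a * Real.Gamma a := mul_pos (by positivity) (Real.Gamma_pos_of_pos ha)
  have hi : Integrable (fun t : ℝ => t ^ (a - 1) * Real.exp (-(r * t))) (volume.restrict (Ioi 0)) := by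
    -- The integral of a non-integrable function is zero by convention, so a nonzero value forces
    -- integrability.
    by_contra hn
    rw [integral_undef hn] at h
    exact hpos.ne h
  rw [← ofReal_integral_eq_lintegral_ofReal hi, h]
  · rw [one_div, Real.inv_rpow hr.le, ← Real.rpow_neg hr.le]
  · filter_upwards [ae_restrict_mem measurableSet_Ioi] with u hu
    have : (0 : ℝ) < u := hu
    simp only [Pi.zero_apply]
    positivity

/-- Write `(b + h) ^ (-p)` as a Gamma integral of `exp (-(b + h) u)` and exchange by Tonelli. Only
the Laplace transform `A u ^ (-q)` of `h` enters, and a second Gamma integral remains. -/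
theorem lintegral_add_rpow_neg {X : Type*} [MeasurableSpace X] (μ : Measure X) [SFinite μ]
    {h : X → ℝ} (hm : Measurable h) (h0 : ∀ x, 0 ≤ h x) {A q p b : ℝ} (hA : 0 ≤ A) (hqp : q < p)
    (hp : 0 < p) (hb : 0 < b) (hint : ∀ u : ℝ, 0 < u →
      ∫⁻ x, ENNReal.ofReal (Real.exp (-(u * h x))) ∂μ = ENNReal.ofReal (A * u ^ (-q))) :
    ∫⁻ x, ENNReal.ofReal ((b + h x) ^ (-p)) ∂μ =
      ENNReal.ofReal (A * Real.Gamma (p - q) / Real.Gamma p * b ^ (-(p - q))) := by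
  have hG := Real.Gamma_pos_of_pos hp
  have h1 : ∀ x, ENNReal.ofReal ((b + h x) ^ (-p)) = ENNReal.ofReal (Real.Gamma p)⁻¹ *
      ∫⁻ u in Ioi (0 : ℝ), ENNReal.ofReal (u ^ (p - 1) * Real.exp (-((b + h x) * u))) := by
    intro x
    rw [lintegral_rpow_mul_exp_neg_mul_Ioi hp (by linarith [h0 x]),
      ← ENNReal.ofReal_mul (by positivity)]
    congr 1
    field_simp
  have hmeas : Measurable (fun y : X × ℝ =>
      ENNReal.ofReal (y.2 ^ (p - 1) * Real.exp (-((b + h y.1) * y.2)))) := by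
    have : Measurable fun y : X × ℝ => h y.1 := hm.comp measurable_fst
    fun_prop
  simp only [h1]
  rw [lintegral_const_mul _ hmeas.lintegral_prod_right', lintegral_lintegral_swap hmeas.aemeasurable]
  have h2 : ∀ u ∈ Ioi (0 : ℝ),
      ∫⁻ x, ENNReal.ofReal (u ^ (p - 1) * Real.exp (-((b + h x) * u))) ∂μ =
      ENNReal.ofReal A * ENNReal.ofReal (u ^ (p - q - 1) * Real.exp (-(b * u))) := by
    intro u hu
    have hu' : (0 : ℝ) < u := hu
    have : ∀ x, ENNReal.ofReal (u ^ (p - 1) * Real.exp (-((b + h x) * u))) =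
        ENNReal.ofReal (u ^ (p - 1) * Real.exp (-(b * u))) *
          ENNReal.ofReal (Real.exp (-(u * h x))) := by
      intro x
      rw [← ENNReal.ofReal_mul (by positivity), _root_.mul_assoc, ← Real.exp_add]
      congr 3
      ring
    simp only [this]
    rw [lintegral_const_mul _ (by fun_prop), hint u hu', ← ENNReal.ofReal_mul (by positivity),
      ← ENNReal.ofReal_mul hA]
    congr 1
    rw [show p - q - 1 = (p - 1) + (-q) by ring, Real.rpow_add hu']
    ring
  rw [setLIntegral_congr_fun measurableSet_Ioi h2, lintegral_const_mul _ (by fun_prop),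
    lintegral_rpow_mul_exp_neg_mul_Ioi (by linarith) hb, ← ENNReal.ofReal_mul hA,
    ← ENNReal.ofReal_mul (by positivity)]
  congr 1
  ring

theorem lintegral_exp_neg_mul_sq {u : ℝ} (hu : 0 < u) :
    ∫⁻ t : ℝ, ENNReal.ofReal (Real.exp (-(u * t ^ 2))) =
      ENNReal.ofReal (Real.sqrt Real.pi * u ^ (-(1 / 2) : ℝ)) := by
  have := integrable_exp_neg_mul_sq hu
  simp only [← neg_mul]
  rw [← ofReal_integral_eq_lintegral_ofReal this (Filter.Eventually.of_forall fun _ => by positivity),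
    integral_gaussian, Real.sqrt_div Real.pi_nonneg, Real.rpow_neg hu.le, ← Real.sqrt_eq_rpow]
  rfl

theorem Complex.integrable_rpow_mul_exp_neg {q : ℝ} (hq : -2 < q) :
    Integrable fun z : ℂ => ‖z‖ ^ q * Real.exp (-‖z‖) := by
  have h := Complex.integral_rpow_mul_exp_neg_rpow (p := 1) le_rfl hq
  simp only [Real.rpow_one] at h
  by_contra hn
  rw [integral_undef hn] at h
  exact (mul_pos (by positivity) (Real.Gamma_pos_of_pos (by linarith))).ne h

theorem Real.integrable_rpow_mul_exp_neg_abs :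
    Integrable fun t : ℝ => |t| ^ (-(1 / 2) : ℝ) * Real.exp (-|t|) := by
  have h := Real.integral_rpow_mul_exp_neg_mul_Ioi (a := 1 / 2) (r := 1) (by norm_num) one_pos
  have h2 := integral_comp_abs (f := fun t : ℝ => t ^ (-(1 / 2) : ℝ) * Real.exp (-t))
  refine Integrable.of_integral_ne_zero ?_
  have h3 : ∫ t in Ioi (0 : ℝ), t ^ (-(1 / 2) : ℝ) * Real.exp (-t) = Real.Gamma (1 / 2) := by
    convert! h using 1
    · norm_num
    · simp
  rw [h2, h3]
  exact (mul_pos two_pos (Real.Gamma_pos_of_pos (by norm_num))).ne'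

end Subordination

namespace Heisenberg

open MeasureTheory

variable {n : ℕ}

/-! ### Gaussian integrals and the normalizing constant -/

theorem lintegral_exp_neg_mul_normSq {u : ℝ} (hu : 0 < u) :
    ∫⁻ z : Fin n → ℂ, ENNReal.ofReal (Real.exp (-(u * normSq z))) =
      ENNReal.ofReal (Real.pi ^ n * u ^ (-(n : ℝ))) := by
  have h2 : ∫ z : ℂ, Real.exp (-u * ‖z‖ ^ (2 : ℝ)) = Real.pi * u ^ (-1 : ℝ) := by
    rw [Complex.integral_exp_neg_mul_rpow (by norm_num) hu]
    norm_num
  have hpos : 0 < Real.pi * u ^ (-1 : ℝ) := by positivity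
  have hi : Integrable fun z : ℂ => Real.exp (-u * ‖z‖ ^ (2 : ℝ)) := by
    by_contra hn
    rw [integral_undef hn] at h2
    exact hpos.ne h2
  have hprod : (fun z : Fin n → ℂ => Real.exp (-(u * normSq z))) =
      fun z => ∏ i, Real.exp (-u * ‖z i‖ ^ (2 : ℝ)) := by
    ext z
    rw [← Real.exp_sum, normSq, Finset.mul_sum, ← Finset.sum_neg_distrib]
    simp
  have hi' : Integrable fun z : Fin n → ℂ => Real.exp (-(u * normSq z)) := by
    rw [hprod]
    exact Integrable.fintype_prod fun _ => hi
  rw [← ofReal_integral_eq_lintegral_ofReal hi' (Filter.Eventually.of_forall fun _ => by positivity),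
    hprod, integral_fintype_prod_volume_eq_prod (fun _ : Fin n => fun z : ℂ => Real.exp (-u * ‖z‖ ^ (2 : ℝ)))]
  simp only [h2, Finset.prod_const, Finset.card_univ, Fintype.card_fin, mul_pow]
  rw [← Real.rpow_natCast (u ^ _) n, ← Real.rpow_mul hu.le]
  simp

theorem measurable_normSq : Measurable (normSq : (Fin n → ℂ) → ℝ) :=
  (contDiff_normSq contDiff_id).continuous.measurable

/-- Subordination is used twice: in `t` with `h = t²` and `b = (1 + |z|²)²`, then in `z` with `h =
|z|²` and `b = 1`. -/
theorem lintegral_regQuartic_one :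
    ∫⁻ ξ : Heis n, ENNReal.ofReal (regQuartic 1 ξ ^ (-((n : ℝ) / 2) - 1)) =
      ENNReal.ofReal (Real.sqrt Real.pi * Real.Gamma (((n : ℝ) + 1) / 2) / Real.Gamma ((n : ℝ) / 2 + 1) *
        (Real.pi ^ n / Real.Gamma ((n : ℝ) + 1))) := by
  have hn : (0 : ℝ) ≤ n := Nat.cast_nonneg n
  have hm : Measurable fun ξ : Heis n => ENNReal.ofReal (regQuartic 1 ξ ^ (-((n : ℝ) / 2) - 1)) :=
    ((contDiff_regQuartic 1).continuous.measurable.pow_const _).ennreal_ofReal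
  rw [Measure.volume_eq_prod, lintegral_prod _ hm.aemeasurable]
  have h1 : ∀ z : Fin n → ℂ, ∫⁻ t : ℝ, ENNReal.ofReal (regQuartic 1 (z, t) ^ (-((n : ℝ) / 2) - 1)) =
      ENNReal.ofReal (Real.sqrt Real.pi * Real.Gamma (((n : ℝ) + 1) / 2) / Real.Gamma ((n : ℝ) / 2 + 1)) *
        ENNReal.ofReal ((1 + normSq z) ^ (-((n : ℝ) + 1))) := by
    intro z
    have hz := normSq_nonneg z
    have := lintegral_add_rpow_neg (volume : Measure ℝ) (h := fun t => t ^ 2) (by fun_prop)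
      (fun t => sq_nonneg t) (Real.sqrt_nonneg Real.pi) (q := 1 / 2) (p := (n : ℝ) / 2 + 1)
      (b := (1 + normSq z) ^ 2) (by linarith) (by positivity) (by positivity)
      (fun u hu => lintegral_exp_neg_mul_sq hu)
    rw [show (n : ℝ) / 2 + 1 - 1 / 2 = ((n : ℝ) + 1) / 2 by ring] at this
    rw [← ENNReal.ofReal_mul (by have := Real.Gamma_pos_of_pos (show 0 < ((n : ℝ) + 1) / 2 by positivity); have := Real.Gamma_pos_of_pos (show 0 < (n : ℝ) / 2 + 1 by positivity); positivity)]
    have h2 : ((1 + normSq z) ^ 2) ^ (-(((n : ℝ) + 1) / 2)) = (1 + normSq z) ^ (-((n : ℝ) + 1)) := by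
      rw [← Real.rpow_natCast, ← Real.rpow_mul (by positivity)]
      congr 1
      push_cast; ring
    rw [← h2, ← this]
    refine lintegral_congr fun t => ?_
    rw [regQuartic, add_comm (normSq z), neg_add, sub_eq_add_neg]
  simp only [h1]
  rw [lintegral_const_mul _ ((measurable_normSq.const_add 1).pow_const _).ennreal_ofReal,
    lintegral_add_rpow_neg (volume : Measure (Fin n → ℂ)) measurable_normSq normSq_nonneg
    (A := Real.pi ^ n) (q := n) (by positivity) (by linarith) (by positivity) one_pos
    (fun u hu => lintegral_exp_neg_mul_normSq hu), ← ENNReal.ofReal_mul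
    (by have := Real.Gamma_pos_of_pos (show 0 < ((n : ℝ) + 1) / 2 by positivity); have := Real.Gamma_pos_of_pos (show 0 < (n : ℝ) / 2 + 1 by positivity); positivity)]
  simp

theorem integrable_regQuartic_one :
    Integrable fun ξ : Heis n => regQuartic 1 ξ ^ (-((n : ℝ) / 2) - 1) := by
  refine ⟨((contDiff_regQuartic 1).continuous.measurable.pow_const _).aestronglyMeasurable, ?_⟩
  rw [hasFiniteIntegral_iff_ofReal (Filter.Eventually.of_forall fun ξ =>
    Real.rpow_nonneg (regQuartic_pos one_pos ξ).le _), lintegral_regQuartic_one]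
  exact ENNReal.ofReal_lt_top

theorem a0_mul_integral (hn : 1 ≤ n) : a0 n * ((n : ℝ) ^ 2 *
    ∫ ξ : Heis n, regQuartic 1 ξ ^ (-((n : ℝ) / 2) - 1)) = 1 := by
  have hn' : (0 : ℝ) < n := by exact_mod_cast hn
  have g1 := Real.Gamma_pos_of_pos (show 0 < ((n : ℝ) + 1) / 2 by positivity)
  have g2 := Real.Gamma_pos_of_pos (show 0 < (n : ℝ) / 2 by positivity)
  have g3 := Real.Gamma_pos_of_pos hn'
  rw [integral_eq_lintegral_of_nonneg_ae (Filter.Eventually.of_forall fun ξ =>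
    Real.rpow_nonneg (regQuartic_pos one_pos ξ).le _) integrable_regQuartic_one.1,
    lintegral_regQuartic_one, Real.Gamma_add_one hn'.ne', Real.Gamma_add_one (by positivity),
    ENNReal.toReal_ofReal (by positivity), a0]
  -- Legendre's duplication formula at `n / 2` merges the two half-step Gamma values into `Γ(n)`.
  have hd := Real.Gamma_mul_Gamma_add_half ((n : ℝ) / 2)
  rw [show (n : ℝ) / 2 + 1 / 2 = ((n : ℝ) + 1) / 2 by ring,
    show 2 * ((n : ℝ) / 2) = n by ring] at hd
  have hs : Real.sqrt Real.pi * Real.sqrt Real.pi = Real.pi := Real.mul_self_sqrt Real.pi_nonneg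
  have h2 : (2 : ℝ) ^ ((n : ℝ) - 2) * 2 ^ (1 - (n : ℝ)) = 1 / 2 := by
    rw [← Real.rpow_add two_pos]
    norm_num
  have key : 2 ^ ((n : ℝ) - 2) * Real.Gamma ((n : ℝ) / 2) * Real.sqrt Real.pi *
      Real.Gamma (((n : ℝ) + 1) / 2) = Real.Gamma n * Real.pi / 2 := by
    linear_combination (2 ^ ((n : ℝ) - 2) * Real.sqrt Real.pi) * hd +
      (Real.Gamma n * Real.sqrt Real.pi * Real.sqrt Real.pi) * h2 + (Real.Gamma n / 2) * hs
  field_simp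
  linear_combination (2 * Real.pi ^ n : ℝ) * key

end Heisenberg
end

noncomputable section

namespace Heisenberg

open MeasureTheory Filter Topology

variable {n : ℕ}

/-! ### Local integrability of the fundamental solution -/

theorem ae_coord_ne_zero : ∀ᵐ ξ : Heis n, (∀ j, ξ.1 j ≠ 0) ∧ ξ.2 ≠ 0 := by
  have h1 : ∀ᵐ z : Fin n → ℂ, ∀ j, z j ≠ 0 := by
    rw [ae_all_iff]
    intro j
    exact Measure.ae_eval_ne (fun _ => volume) j 0
  have h2 : ∀ᵐ t : ℝ, t ≠ 0 := Measure.ae_ne volume 0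
  rw [Measure.volume_eq_prod]
  exact (Measure.quasiMeasurePreserving_fst.ae h1).and (Measure.quasiMeasurePreserving_snd.ae h2)

theorem integrableOn_quartic_rpow (hn : 1 ≤ n) (B : ℝ) :
    IntegrableOn (fun ξ : Heis n => quartic ξ ^ (-((n : ℝ) / 2))) (Metric.closedBall 0 B) := by
  have hn' : (0 : ℝ) < n := by exact_mod_cast hn
  -- Chosen so that `n * (q / 4) - 1 / 4 = -n / 2` while `q > -2`: the kernel is then bounded by a
  -- product of `‖z_j‖ ^ q`, integrable at the origin of `ℂ`, and `|t| ^ (-1/2)`, integrable at the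
  -- origin of `ℝ`.
  set q : ℝ := -(2 * n - 1) / n with hq
  have hq2 : -2 < q := by
    rw [hq, lt_div_iff₀ hn']; linarith
  have hq0 : q < 0 := by
    have : (1 : ℝ) ≤ n := by exact_mod_cast hn
    exact div_neg_of_neg_of_pos (by linarith) hn'
  have h1 : Integrable fun z : Fin n → ℂ => ∏ j, ‖z j‖ ^ q * Real.exp (-‖z j‖) :=
    Integrable.fintype_prod fun _ => Complex.integrable_rpow_mul_exp_neg hq2
  have h2 : Integrable fun ξ : Heis n => (∏ j, ‖ξ.1 j‖ ^ q * Real.exp (-‖ξ.1 j‖)) *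
      (|ξ.2| ^ (-(1 / 2) : ℝ) * Real.exp (-|ξ.2|)) := by
    rw [Measure.volume_eq_prod]
    exact h1.mul_prod Real.integrable_rpow_mul_exp_neg_abs
  -- The exponentials make the product integrable globally; on the ball they are at least `exp (-(n
  -- * B + B))`, which this constant compensates.
  refine Integrable.mono' (h2.const_mul (Real.exp (n * B + B))).integrableOn
    (continuous_quartic.measurable.pow_const _).aestronglyMeasurable ?_
  filter_upwards [ae_restrict_mem measurableSet_closedBall, ae_restrict_of_ae ae_coord_ne_zero]
    with ξ hB ⟨hz, ht⟩
  rw [Metric.mem_closedBall, dist_zero_right] at hB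
  have hx : 0 < quartic ξ := quartic_pos fun h => ht (by rw [h]; rfl)
  rw [Real.norm_of_nonneg (by positivity)]
  have hsplit : quartic ξ ^ (-((n : ℝ) / 2)) =
      (∏ _j : Fin n, quartic ξ ^ (q / 4)) * quartic ξ ^ (-(1 / 4) : ℝ) := by
    rw [Finset.prod_const, Finset.card_univ, Fintype.card_fin, ← Real.rpow_natCast,
      ← Real.rpow_mul hx.le, ← Real.rpow_add hx]
    congr 1
    rw [hq]
    field_simp
    ring
  have hz4 : ∀ j, ‖ξ.1 j‖ ^ 4 ≤ quartic ξ := by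
    intro j
    have h : ‖ξ.1 j‖ ^ 2 ≤ normSq ξ.1 :=
      Finset.single_le_sum (f := fun j => ‖ξ.1 j‖ ^ 2) (fun _ _ => by positivity) (Finset.mem_univ j)
    have := pow_le_pow_left₀ (by positivity) h 2
    unfold quartic
    nlinarith [sq_nonneg ξ.2]
  have hzj : ∀ j, quartic ξ ^ (q / 4) ≤ ‖ξ.1 j‖ ^ q := by
    intro j
    have h0 : 0 < ‖ξ.1 j‖ := norm_pos_iff.2 (hz j)
    calc quartic ξ ^ (q / 4) ≤ (‖ξ.1 j‖ ^ 4) ^ (q / 4) :=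
          Real.rpow_le_rpow_of_nonpos (by positivity) (hz4 j) (by linarith)
      _ = ‖ξ.1 j‖ ^ q := by
          rw [← Real.rpow_natCast, ← Real.rpow_mul h0.le]
          congr 1; push_cast; ring
  have htj : quartic ξ ^ (-(1 / 4) : ℝ) ≤ |ξ.2| ^ (-(1 / 2) : ℝ) := by
    have h0 : 0 < |ξ.2| := abs_pos.2 ht
    have h2 : |ξ.2| ^ 2 ≤ quartic ξ := by
      rw [sq_abs]; unfold quartic; nlinarith [sq_nonneg (normSq ξ.1)]
    calc quartic ξ ^ (-(1 / 4) : ℝ) ≤ (|ξ.2| ^ 2) ^ (-(1 / 4) : ℝ) :=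
          Real.rpow_le_rpow_of_nonpos (by positivity) h2 (by norm_num)
      _ = |ξ.2| ^ (-(1 / 2) : ℝ) := by
          rw [← Real.rpow_natCast, ← Real.rpow_mul h0.le]
          norm_num
  have hexp : 1 ≤ Real.exp (n * B + B) * ((∏ j, Real.exp (-‖ξ.1 j‖)) * Real.exp (-|ξ.2|)) := by
    rw [← Real.exp_sum, ← Real.exp_add, ← Real.exp_add]
    apply Real.one_le_exp
    have h1 : ∑ j, -‖ξ.1 j‖ ≥ ∑ _j : Fin n, -B := Finset.sum_le_sum fun j _ =>
      neg_le_neg (((norm_le_pi_norm ξ.1 j).trans (norm_fst_le ξ)).trans hB)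
    simp only [Finset.sum_const, Finset.card_univ, Fintype.card_fin, nsmul_eq_mul] at h1
    have h2 : |ξ.2| ≤ B := (norm_snd_le ξ).trans hB
    linarith
  rw [hsplit]
  calc (∏ _j : Fin n, quartic ξ ^ (q / 4)) * quartic ξ ^ (-(1 / 4) : ℝ)
      ≤ (∏ j, ‖ξ.1 j‖ ^ q) * |ξ.2| ^ (-(1 / 2) : ℝ) :=
        mul_le_mul (Finset.prod_le_prod (fun _ _ => by positivity) fun j _ => hzj j) htj
          (by positivity) (Finset.prod_nonneg fun _ _ => by positivity)
    _ ≤ ((∏ j, ‖ξ.1 j‖ ^ q) * |ξ.2| ^ (-(1 / 2) : ℝ)) *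
        (Real.exp (n * B + B) * ((∏ j, Real.exp (-‖ξ.1 j‖)) * Real.exp (-|ξ.2|))) :=
        le_mul_of_one_le_right (mul_nonneg (Finset.prod_nonneg fun _ _ => by positivity)
          (by positivity)) hexp
    _ = _ := by
        rw [Finset.prod_mul_distrib]; ring

/-! ### The fundamental solution -/

theorem regQuartic_dil (r : ℝ) (ξ : Heis n) :
    regQuartic (r ^ 2) (dil r ξ) = r ^ 4 * regQuartic 1 ξ := by
  simp only [regQuartic, dil, normSq_smul, Complex.norm_real, Real.norm_eq_abs, sq_abs]
  ring

/-- The choice `ε = r²` makes the density a dilate of the one for `ε = 1`; the Jacobian `r ^ (2n +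
2)`, the factor `r²` and the homogeneity `r ^ (-2n - 4)` cancel exactly. -/
theorem integral_regSol_sq_smul_L0 {r : ℝ} (hr : 0 < r) {f : Heis n → ℂ} (hf : ContDiff ℝ ∞ f)
    (hc : HasCompactSupport f) : ∫ ξ, regSol (r ^ 2) ξ • L0 f ξ =
      (n : ℝ) ^ 2 • ∫ ξ, regQuartic 1 ξ ^ (-((n : ℝ) / 2) - 1) • f (dil r ξ) := by
  have hm : AEStronglyMeasurable fun ξ : Heis n =>
      (r ^ 2 * regQuartic (r ^ 2) ξ ^ (-((n : ℝ) / 2) - 1)) • f ξ :=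
    ((((contDiff_regQuartic (r ^ 2)).continuous.measurable.pow_const _).const_mul
      _).aestronglyMeasurable).smul hf.continuous.aestronglyMeasurable
  rw [integral_regSol_smul_L0 (by positivity) hf hc, integral_comp_dil hr hm, ← integral_smul]
  congr 2
  ext ξ
  rw [regQuartic_dil, smul_smul, Real.mul_rpow (by positivity) (regQuartic_pos one_pos ξ).le,
    ← Real.rpow_natCast r 4, ← Real.rpow_mul hr.le, ← _root_.mul_assoc, ← _root_.mul_assoc, ← pow_add,
    ← Real.rpow_natCast r (2 * n + 2 + 2), ← Real.rpow_add hr]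
  have : ((2 * n + 2 + 2 : ℕ) : ℝ) + ((4 : ℕ) : ℝ) * (-((n : ℝ) / 2) - 1) = 0 := by
    push_cast; ring
  rw [this, Real.rpow_zero, one_mul]

theorem tendsto_integral_regQuartic_smul {f : Heis n → ℂ} (hf : Continuous f)
    (hc : HasCompactSupport f) :
    Tendsto (fun r : ℝ => ∫ ξ, regQuartic 1 ξ ^ (-((n : ℝ) / 2) - 1) • f (dil r ξ)) (𝓝[>] 0)
      (𝓝 ((∫ ξ : Heis n, regQuartic 1 ξ ^ (-((n : ℝ) / 2) - 1)) • f 0)) := by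
  obtain ⟨C, hC⟩ := hc.exists_bound_of_continuous hf
  have hmeas : Measurable fun ξ : Heis n => regQuartic 1 ξ ^ (-((n : ℝ) / 2) - 1) :=
    (contDiff_regQuartic 1).continuous.measurable.pow_const _
  rw [← integral_smul_const]
  refine tendsto_integral_filter_of_dominated_convergence
    (fun ξ : Heis n => regQuartic 1 ξ ^ (-((n : ℝ) / 2) - 1) * C) ?_ ?_ ?_ ?_
  · exact Eventually.of_forall fun r => hmeas.aestronglyMeasurable.smul
      (hf.comp (continuous_dil r)).aestronglyMeasurable
  · refine Eventually.of_forall fun r => Eventually.of_forall fun ξ => ?_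
    have := Real.rpow_nonneg (regQuartic_pos one_pos ξ).le (-((n : ℝ) / 2) - 1)
    rw [norm_smul, Real.norm_of_nonneg this]
    exact mul_le_mul_of_nonneg_left (hC _) this
  · exact integrable_regQuartic_one.mul_const C
  · refine Eventually.of_forall fun ξ => ?_
    refine Tendsto.const_smul ?_ _
    have h : Continuous fun r : ℝ => f (dil r ξ) :=
      hf.comp (contDiff_dil (f := fun _ => ξ) contDiff_id contDiff_const).continuous
    have h2 := h.tendsto 0
    have h3 : dil 0 ξ = 0 := by
      refine Prod.ext ?_ ?_
      · funext j; simp [dil]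
      · simp [dil]
    rw [h3] at h2
    exact h2.mono_left nhdsWithin_le_nhds

/-- Regularizing only increases the quartic, so the unregularized kernel, locally integrable,
dominates. -/
theorem tendsto_integral_regSol_smul (hn : 1 ≤ n) {g : Heis n → ℂ} (hg : Continuous g)
    (hc : HasCompactSupport g) :
    Tendsto (fun r : ℝ => ∫ ξ, regSol (r ^ 2) ξ • g ξ) (𝓝[>] 0)
      (𝓝 (∫ ξ, quartic ξ ^ (-((n : ℝ) / 2)) • g ξ)) := by
  obtain ⟨C, hC⟩ := hc.exists_bound_of_continuous hg
  obtain ⟨B, hB⟩ := hc.isBounded.subset_closedBall (0 : Heis n)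
  have hne : ∀ᵐ ξ : Heis n, ξ ≠ 0 := by
    filter_upwards [ae_coord_ne_zero (n := n)] with ξ hξ h
    exact hξ.2 (by rw [h]; rfl)
  have hm : Measurable fun ξ : Heis n => quartic ξ ^ (-((n : ℝ) / 2)) :=
    continuous_quartic.measurable.pow_const _
  refine tendsto_integral_filter_of_dominated_convergence
    (fun ξ => quartic ξ ^ (-((n : ℝ) / 2)) * ‖g ξ‖) ?_ ?_ ?_ ?_
  · filter_upwards [self_mem_nhdsWithin] with r hr
    exact ((contDiff_regSol (pow_pos hr 2)).continuous.smul hg).aestronglyMeasurable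
  · filter_upwards [self_mem_nhdsWithin] with r hr
    filter_upwards [hne] with ξ hξ
    rw [norm_smul, regSol, Real.norm_of_nonneg
      (Real.rpow_nonneg (regQuartic_pos (pow_pos hr 2) ξ).le _)]
    refine mul_le_mul_of_nonneg_right ?_ (norm_nonneg _)
    refine Real.rpow_le_rpow_of_nonpos (quartic_pos hξ) ?_ (by
      have : (0 : ℝ) ≤ n := Nat.cast_nonneg n
      linarith)
    have := normSq_nonneg ξ.1
    unfold quartic regQuartic
    gcongr
    nlinarith [sq_nonneg r]
  · have h1 := (integrableOn_quartic_rpow hn B).mul_bdd (c := C) (g := fun ξ => ‖g ξ‖)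
      hg.norm.aestronglyMeasurable (Eventually.of_forall fun ξ => by simpa using hC ξ)
    refine (integrableOn_iff_integrable_of_support_subset ?_).1 h1
    intro ξ hξ
    apply hB
    apply subset_tsupport
    intro h
    simp [h] at hξ
  · filter_upwards [hne] with ξ hξ
    refine Tendsto.smul_const ?_ _
    have h : ContinuousAt (fun r : ℝ => regQuartic (r ^ 2) ξ ^ (-((n : ℝ) / 2))) 0 := by
      refine ContinuousAt.rpow_const ?_ (Or.inl ?_)
      · unfold regQuartic; fun_prop
      · rw [zero_pow two_ne_zero, regQuartic_zero]; exact (quartic_pos hξ).ne'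
    have h2 := h.tendsto
    rw [zero_pow two_ne_zero, regQuartic_zero] at h2
    exact h2.mono_left nhdsWithin_le_nhds

/-- The same quantity has two limits as `r → 0`: the regularized kernel tends to the singular one,
and the approximate identity tends to its mass times `f 0`. The constant `a0 n` normalizes the
product to one. -/
theorem integral_fundSol_smul_L0 (hn : 1 ≤ n) {f : Heis n → ℂ} (hf : ContDiff ℝ ∞ f)
    (hc : HasCompactSupport f) : ∫ ξ, fundSol ξ • L0 f ξ = f 0 := by
  have h1 := tendsto_integral_regSol_smul hn (continuous_L0 hf) (hasCompactSupport_L0 hf hc)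
  have h2 := (tendsto_integral_regQuartic_smul hf.continuous hc).const_smul ((n : ℝ) ^ 2)
  have h3 : (fun r : ℝ => ∫ ξ, regSol (r ^ 2) ξ • L0 f ξ) =ᶠ[𝓝[>] 0] fun r : ℝ =>
      (n : ℝ) ^ 2 • ∫ ξ, regQuartic 1 ξ ^ (-((n : ℝ) / 2) - 1) • f (dil r ξ) := by
    filter_upwards [self_mem_nhdsWithin] with r hr using integral_regSol_sq_smul_L0 hr hf hc
  have h4 := tendsto_nhds_unique (h1.congr' h3) h2
  simp only [fundSol_eq, mul_smul]
  rw [integral_smul, h4, smul_smul, smul_smul, _root_.mul_assoc, a0_mul_integral hn, one_smul]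

theorem quartic_inv_mul_comm (ξ η : Heis n) : quartic (mul (inv ξ) η) = quartic (mul (inv η) ξ) := by
  rw [quartic_inv_mul, quartic_inv_mul, ← Complex.norm_conj]
  congr 2
  have h : (starRingEnd ℂ) (dotConj ξ.1 η.1) = dotConj η.1 ξ.1 := by
    simp [dotConj, mul_comm]
  rw [← h]
  simp only [map_add, map_sub, map_mul, map_ofNat, Complex.conj_conj]
  ring

theorem fundSolAt_comm (η ξ : Heis n) : fundSolAt η ξ = fundSol (mul (inv η) ξ) := by
  rw [fundSolAt, fundSol_eq, quartic_inv_mul_comm, fundSol_eq]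

theorem inv_mul_cancel_left (η ξ : Heis n) : mul (inv η) (mul η ξ) = ξ := by
  rw [← mul_assoc, inv_mul_self]
  simp [mul, dotConj]

theorem measurable_fundSol : Measurable (fundSol : Heis n → ℝ) :=
  (continuous_quartic.measurable.pow_const _).const_mul _

theorem integral_fundSolAt_smul_L0 (hn : 1 ≤ n) (η : Heis n) {f : Heis n → ℂ}
    (hf : ContDiff ℝ ∞ f) (hc : HasCompactSupport f) :
    ∫ ξ, fundSolAt η ξ • L0 f ξ = f η := by
  have hmul : ∀ η : Heis n, ContDiff ℝ ∞ fun ξ => mul η ξ := fun η =>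
    contDiff_mul contDiff_const contDiff_id
  have hf' : ContDiff ℝ ∞ fun ξ => f (mul η ξ) := hf.comp (hmul η)
  have hc' : HasCompactSupport fun ξ => f (mul η ξ) := by
    refine HasCompactSupport.intro (hc.isCompact.image (hmul (inv η)).continuous) fun ξ hξ => ?_
    by_contra h
    exact hξ ⟨mul η ξ, subset_tsupport _ h, inv_mul_cancel_left η ξ⟩
  have h := integral_fundSol_smul_L0 hn hf' hc'
  simp only [L0_comp_mul hf] at h
  have h0 : mul η 0 = η := by simp [mul, dotConj]
  rw [h0] at h
  rw [← h]
  have hm : AEStronglyMeasurable (fun ξ => fundSolAt η ξ • L0 f ξ)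
      ((volume : Measure (Heis n)).map (mul η)) := by
    simp only [fundSolAt_comm]
    exact (measurable_fundSol.comp (hmul (inv η)).continuous.measurable).aestronglyMeasurable.smul
      (continuous_L0 hf).aestronglyMeasurable
  have h2 := integral_map (hmul η).continuous.aemeasurable hm
  rw [(measurePreserving_mul_left η).map_eq] at h2
  rw [h2]
  simp only [fundSolAt_comm, inv_mul_cancel_left]

end Heisenberg
end

noncomputable section

namespace Heisenberg

open MeasureTheory Filter Topology

variable {n : ℕ}

/-! ### The averaged fundamental solution -/

theorem fundSolAt_rot_eq (η : Heis n) (θ : ℝ) (ξ : Heis n) :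
    fundSolAt η (rot θ ξ) = fundSol (mul (inv (rot (-θ) η)) ξ) := by
  rw [fundSolAt_rot, fundSolAt_comm]

theorem measurable_fundSolAt_rot (η : Heis n) :
    Measurable fun y : ℝ × Heis n => fundSolAt η (rot y.1 y.2) := by
  simp only [fundSolAt_comm]
  exact measurable_fundSol.comp (contDiff_mul contDiff_const
    (contDiff_rot contDiff_fst contDiff_snd)).continuous.measurable

theorem lintegral_fundSol_lt_top (hn : 1 ≤ n) (B : ℝ) :
    ∫⁻ ξ in Metric.closedBall (0 : Heis n) B, ‖fundSol ξ‖ₑ < ⊤ :=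
  ((integrableOn_quartic_rpow hn B).const_mul (a0 n)).2

theorem integrable_fundSolAt_rot (hn : 1 ≤ n) (η : Heis n) {K : Set (Heis n)} (hK : IsCompact K) :
    Integrable (fun y : ℝ × Heis n => fundSolAt η (rot y.1 y.2))
      ((volume.restrict (Set.Ioc 0 (2 * Real.pi))).prod (volume.restrict K)) := by
  have hm := measurable_fundSolAt_rot η
  refine ⟨hm.aestronglyMeasurable, ?_⟩
  have hcont : Continuous fun y : ℝ × Heis n => mul (inv (rot (-y.1) η)) y.2 :=
    (contDiff_mul (contDiff_inv (contDiff_rot contDiff_fst.neg contDiff_const))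
      contDiff_snd).continuous
  obtain ⟨B, hB⟩ := (((isCompact_Icc (a := (0 : ℝ)) (b := 2 * Real.pi)).prod hK).image
    hcont).isBounded.subset_closedBall (0 : Heis n)
  rw [hasFiniteIntegral_def, lintegral_prod _ hm.enorm.aemeasurable]
  -- For each angle a left translation moves the pole to the origin; by compactness in the angle the
  -- translates of `K` all lie in one ball, so the bound is uniform.
  have hbound : ∀ θ ∈ Set.Ioc (0 : ℝ) (2 * Real.pi),
      ∫⁻ ξ in K, ‖fundSolAt η (rot θ ξ)‖ₑ ≤
        ∫⁻ ξ in Metric.closedBall (0 : Heis n) B, ‖fundSol ξ‖ₑ := by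
    intro θ hθ
    simp only [fundSolAt_rot_eq]
    rw [← lintegral_indicator hK.measurableSet, ← lintegral_indicator measurableSet_closedBall,
      ← (measurePreserving_mul_left (inv (rot (-θ) η))).lintegral_comp
        (measurable_fundSol.enorm.indicator measurableSet_closedBall)]
    refine lintegral_mono fun ξ => ?_
    by_cases hξ : ξ ∈ K
    · have : mul (inv (rot (-θ) η)) ξ ∈ Metric.closedBall (0 : Heis n) B :=
        hB ⟨(θ, ξ), ⟨Set.Ioc_subset_Icc_self hθ, hξ⟩, rfl⟩
      rw [Set.indicator_of_mem hξ, Set.indicator_of_mem this]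
    · rw [Set.indicator_of_notMem hξ]
      exact zero_le
  refine (setLIntegral_mono' measurableSet_Ioc hbound).trans_lt ?_
  rw [setLIntegral_const]
  exact ENNReal.mul_lt_top (lintegral_fundSol_lt_top hn B)
    (by rw [Real.volume_Ioc]; exact ENNReal.ofReal_lt_top)

theorem avgSol_eq (η ξ : Heis n) : avgSol η ξ =
    (2 * Real.pi)⁻¹ * ∫ θ in Set.Ioc 0 (2 * Real.pi), fundSolAt η (rot θ ξ) := by
  rw [avgSol, circAvg, intervalIntegral.integral_of_le (by positivity), smul_eq_mul]

theorem integrableOn_avgSol (hn : 1 ≤ n) (η : Heis n) {K : Set (Heis n)} (hK : IsCompact K) :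
    IntegrableOn (avgSol η) K := by
  have h : avgSol η = fun ξ =>
    (2 * Real.pi)⁻¹ * ∫ θ in Set.Ioc 0 (2 * Real.pi), fundSolAt η (rot θ ξ) := funext (avgSol_eq η)
  rw [h]
  exact (integrable_fundSolAt_rot hn η hK).integral_prod_right.const_mul _

theorem integrable_avgSol_smul (hn : 1 ≤ n) (η : Heis n) {g : Heis n → ℂ} (hg : Continuous g)
    (hc : HasCompactSupport g) : Integrable fun ξ => avgSol η ξ • g ξ := by
  obtain ⟨C, hC⟩ := hc.exists_bound_of_continuous hg
  have h1 : IntegrableOn (fun ξ => avgSol η ξ • g ξ) (tsupport g) :=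
    (integrableOn_avgSol hn η hc.isCompact).smul_bdd C hg.aestronglyMeasurable
      (Eventually.of_forall hC)
  refine (integrableOn_iff_integrable_of_support_subset ?_).1 h1
  intro ξ hξ
  apply subset_tsupport
  intro h
  simp [h] at hξ

/-- Rotating the argument is rotating the pole backwards, so Fubini turns the average of kernels
into the average of `f` over the circle through `η`. -/
theorem integral_avgSol_smul_L0 (hn : 1 ≤ n) (η : Heis n) {f : Heis n → ℂ}
    (hf : ContDiff ℝ ∞ f) (hc : HasCompactSupport f) :
    ∫ ξ, avgSol η ξ • L0 f ξ = circAvg f η := by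
  obtain ⟨C, hC⟩ := (hasCompactSupport_L0 hf hc).exists_bound_of_continuous (continuous_L0 hf)
  have hint : Integrable (fun y : ℝ × Heis n => fundSolAt η (rot y.1 y.2) • L0 f y.2)
      ((volume.restrict (Set.Ioc 0 (2 * Real.pi))).prod (volume.restrict (tsupport f))) :=
    (integrable_fundSolAt_rot hn η hc.isCompact).smul_bdd C
      ((continuous_L0 hf).comp continuous_snd).aestronglyMeasurable
      (Eventually.of_forall fun y => hC y.2)
  have hset : ∀ u : Heis n → ℝ, ∫ ξ in tsupport f, u ξ • L0 f ξ = ∫ ξ, u ξ • L0 f ξ := by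
    intro u
    refine setIntegral_eq_integral_of_forall_compl_eq_zero fun ξ hξ => ?_
    rw [L0_eq_zero_of_notMem_tsupport hf hξ, smul_zero]
  have h1 : ∀ ξ, avgSol η ξ • L0 f ξ = (2 * Real.pi)⁻¹ •
      ∫ θ in Set.Ioc 0 (2 * Real.pi), fundSolAt η (rot θ ξ) • L0 f ξ := by
    intro ξ
    rw [avgSol_eq, integral_smul_const, smul_smul]
  have h2 : ∀ θ : ℝ, ∫ ξ, fundSolAt η (rot θ ξ) • L0 f ξ = f (rot (-θ) η) := by
    intro θ
    simp only [fundSolAt_rot]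
    exact integral_fundSolAt_smul_L0 hn _ hf hc
  have hp : Function.Periodic (fun θ : ℝ => f (rot θ η)) (2 * Real.pi) := (rot_periodic η).comp f
  rw [← hset]
  simp only [h1]
  rw [integral_smul, ← integral_integral_swap hint]
  simp only [hset, h2]
  rw [circAvg, ← intervalIntegral.integral_of_le (by positivity),
    intervalIntegral.integral_comp_neg (fun θ => f (rot θ η)), neg_zero]
  have := hp.intervalIntegral_add_eq (-(2 * Real.pi)) 0
  rw [neg_add_cancel, zero_add] at this
  rw [this]

theorem integral_avgSol_smul_L0_eq_zero (hn : 1 ≤ n) {R : ℝ} (η : Heis n)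
    (hη : η ∉ annulus n R) {f : Heis n → ℂ} (hf : ContDiff ℝ ∞ f) (hc : HasCompactSupport f)
    (hs : tsupport f ⊆ annulus n R) : ∫ ξ, avgSol η ξ • L0 f ξ = 0 := by
  have h : ∀ θ : ℝ, f (rot θ η) = 0 := by
    intro θ
    refine image_eq_zero_of_notMem_tsupport fun h' => hη ?_
    have := hs h'
    exact ⟨by simpa only [gauge_rot] using this.1, by simpa only [gauge_rot] using this.2⟩
  rw [integral_avgSol_smul_L0 hn η hf hc, circAvg]
  simp [h]

end Heisenberg
end

noncomputable section

namespace Heisenberg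

open MeasureTheory Filter Topology

variable {n : ℕ}

/-! ### The series of images -/

/-- The closed annulus `{ξ : R ≤ N(ξ) ≤ 1}`. -/
def closedAnnulus (n : ℕ) (R : ℝ) : Set (Heis n) := {ξ | R ≤ gauge ξ ∧ gauge ξ ≤ 1}

theorem annulus_subset_closedAnnulus (n : ℕ) (R : ℝ) : annulus n R ⊆ closedAnnulus n R :=
  fun _ h => ⟨h.1.le, h.2.le⟩

theorem isOpen_annulus (n : ℕ) (R : ℝ) : IsOpen (annulus n R) :=
  (isOpen_lt continuous_const continuous_gauge).inter (isOpen_lt continuous_gauge continuous_const)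

theorem isClosed_orbit (η : Heis n) : IsClosed (orbit η) := by
  have h : orbit η = (fun θ => rot θ η) '' Set.Icc 0 (2 * Real.pi) := by
    refine Set.Subset.antisymm ?_ (Set.image_subset_range _ _)
    rintro _ ⟨θ, rfl⟩
    obtain ⟨y, hy, hy'⟩ := (rot_periodic η).exists_mem_Ico₀ (by positivity) θ
    exact ⟨y, Set.Ico_subset_Icc_self hy, hy'.symm⟩
  rw [h]
  exact (isCompact_Icc.image (contDiff_rot (f := fun _ => η) contDiff_id
    contDiff_const).continuous).isClosed

/-- The terms of `F` are bounded by summable constants on compact subsets of `S`. -/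
def HasMajorants (F : ℕ → Heis n → ℝ) (S : Set (Heis n)) : Prop :=
  ∀ C ⊆ S, IsCompact C → ∃ b : ℕ → ℝ, Summable b ∧ ∀ k, ∀ ξ ∈ C, |F k ξ| ≤ b k

namespace HasMajorants

variable {F F' : ℕ → Heis n → ℝ} {S : Set (Heis n)}

theorem summable (h : HasMajorants F S) {ξ : Heis n} (hξ : ξ ∈ S) : Summable fun k => F k ξ := by
  obtain ⟨b, hb, h⟩ := h {ξ} (Set.singleton_subset_iff.2 hξ) isCompact_singleton
  exact Summable.of_norm_bounded hb fun k => h k ξ rfl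

theorem sub (h : HasMajorants F S) (h' : HasMajorants F' S) :
    HasMajorants (fun k ξ => F k ξ - F' k ξ) S := by
  intro C hC hc
  obtain ⟨b, hb, h⟩ := h C hC hc
  obtain ⟨b', hb', h'⟩ := h' C hC hc
  exact ⟨_, hb.add hb', fun k ξ hξ => (abs_sub _ _).trans (add_le_add (h k ξ hξ) (h' k ξ hξ))⟩

theorem mono {T : Set (Heis n)} (h : HasMajorants F S) (hT : T ⊆ S) : HasMajorants F T :=
  fun C hC => h C (hC.trans hT)

theorem of_succ (h0 : ContinuousOn (F 0) S) (h : HasMajorants (fun k => F (k + 1)) S) :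
    HasMajorants F S := by
  intro C hC hc
  obtain ⟨b, hb, h⟩ := h C hC hc
  obtain ⟨B, hB⟩ := hc.exists_bound_of_continuousOn (h0.mono hC)
  -- The bound for the zeroth term is prepended to the sequence of majorants.
  refine ⟨fun k => Nat.casesOn k B b, (summable_nat_add_iff 1).1 hb, fun k ξ hξ => ?_⟩
  cases k with
  | zero => exact hB ξ hξ
  | succ k => exact h k ξ hξ

theorem summableLocallyUniformlyOn_abs (hS : IsOpen S) (h : HasMajorants F S) :
    SummableLocallyUniformlyOn (fun k ξ => |F k ξ|) S := by
  refine SummableLocallyUniformlyOn_of_locally_bounded hS fun C hC hc => ?_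
  obtain ⟨b, hb, h⟩ := h C hC hc
  exact ⟨b, hb, fun k x hx => by simpa using h k x hx⟩

theorem hasSumLocallyUniformlyOn (hS : IsOpen S) (h : HasMajorants F S) :
    HasSumLocallyUniformlyOn F (fun ξ => ∑' k, F k ξ) S := by
  refine SummableLocallyUniformlyOn.hasSumLocallyUniformlyOn ?_
  refine SummableLocallyUniformlyOn_of_locally_bounded hS fun C hC hc => ?_
  obtain ⟨b, hb, h⟩ := h C hC hc
  exact ⟨b, hb, fun k x hx => h k x hx⟩

end HasMajorants

/-- A series of multiples of averaged fundamental solutions with poles off the annulus, converging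
smoothly on the closed annulus. -/
structure ImageSeries (R : ℝ) (F : ℕ → Heis n → ℝ) : Prop where
  hasMajorants : HasMajorants F (closedAnnulus n R)
  contDiffAt : ∀ ξ ∈ closedAnnulus n R, ContDiffAt ℝ ∞ (fun x => ∑' k, F k x) ξ
  pole : ∀ k, ∃ (c : ℝ) (ζ : Heis n), ζ ∉ annulus n R ∧ ∀ ξ, ξ ≠ 0 → F k ξ = c * avgSol ζ ξ

theorem ne_zero_of_mem_closedAnnulus {R : ℝ} (hR : 0 < R) {ξ : Heis n}
    (h : ξ ∈ closedAnnulus n R) : ξ ≠ 0 := by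
  rintro rfl
  have := h.1
  rw [gauge_eq_zero.2 rfl] at this
  linarith

/-- All terms are one kernel with base pole `ζ`, sampled at dilation parameters in a compact set
that avoids the singularity for every point of the closed annulus. -/
theorem imageSeries_of_family {R : ℝ} (hR : 0 < R) {F : ℕ → Heis n → ℝ} {ζ : Heis n}
    {K : Set (ℝ × ℝ)} (hK : IsCompact K) {p : ℕ → ℝ × ℝ} (hp : ∀ k, p k ∈ K) {c : ℕ → ℝ}
    (hc : ∀ k, 0 ≤ c k) (hcs : Summable c)
    (hreg : ∀ x ∈ K, ∀ ξ ∈ closedAnnulus n R, (x, ξ) ∈ regularSet ζ)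
    (hF : ∀ k ξ, ξ ≠ 0 → F k ξ = c k * avgFamily ζ (p k, ξ))
    (hpole : ∀ k, ∃ (c : ℝ) (ζ' : Heis n), ζ' ∉ annulus n R ∧
      ∀ ξ, ξ ≠ 0 → F k ξ = c * avgSol ζ' ξ) : ImageSeries R F where
  pole := hpole
  hasMajorants := by
    intro C hC hCc
    obtain ⟨B, u, -, hCu, hB⟩ := exists_bound_near_compact hK hCc (isOpen_regularSet ζ)
      (contDiffOn_avgFamily ζ).continuousOn (fun y hy => hreg y.1 hy.1 y.2 (hC hy.2))
    refine ⟨fun k => c k * B, hcs.mul_right B, fun k ξ hξ => ?_⟩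
    rw [hF k ξ (ne_zero_of_mem_closedAnnulus hR (hC hξ)), abs_mul, abs_of_nonneg (hc k)]
    exact mul_le_mul_of_nonneg_left (hB (p k) (hp k) ξ (hCu hξ)).2 (hc k)
  contDiffAt := by
    intro ξ hξ
    have h := contDiffAt_tsum_of_contDiffOn hK hp hc hcs (isOpen_regularSet ζ)
      (contDiffOn_avgFamily ζ) (ξ := ξ) (by
        rintro ⟨x, y⟩ ⟨hx, rfl⟩
        exact hreg x hx y hξ)
    refine h.congr_of_eventuallyEq ?_
    filter_upwards [isOpen_ne.mem_nhds (ne_zero_of_mem_closedAnnulus hR hξ)] with x hx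
    exact tsum_congr fun k => hF k x hx

variable {R : ℝ}

theorem summable_pow_two_mul (hn : 1 ≤ n) (hR0 : 0 < R) (hR1 : R < 1) :
    Summable fun k : ℕ => (R ^ (2 * n)) ^ k :=
  summable_geometric_of_lt_one (by positivity) (pow_lt_one₀ hR0.le hR1 (by omega))

theorem imageSeries_M (hn : 1 ≤ n) (hR0 : 0 < R) (hR1 : R < 1) {η : Heis n}
    (hη : η ∈ annulus n R) : ImageSeries R fun k => M R η (k + 1) := by
  have hR2 : R ^ 2 < 1 := pow_lt_one₀ hR0.le hR1 two_ne_zero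
  have hpow : ∀ k : ℕ, (R ^ 2) ^ (k + 1) ≤ R ^ 2 := fun k => by
    rw [pow_succ]; exact mul_le_of_le_one_left (by positivity) (pow_le_one₀ (by positivity) hR2.le)
  have hsmall : ∀ α, 0 ≤ α → α ≤ R ^ 2 → gauge (dil α η) < R := by
    intro α h0 h1
    rw [gauge_dil h0]
    nlinarith [hη.2, gauge_nonneg η]
  -- The parameter interval includes the limit `0`, where the pole is the origin. The index starts
  -- at `k + 1` because the pole of the zeroth term lies in the annulus.
  refine imageSeries_of_family (ζ := η) hR0 (K := Set.Icc 0 (R ^ 2) ×ˢ {1})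
    (isCompact_Icc.prod isCompact_singleton) (p := fun k => ((R ^ 2) ^ (k + 1), 1))
    (fun k => ⟨⟨by positivity, hpow k⟩, rfl⟩) (c := fun k => (R ^ (2 * n)) ^ (k + 1))
    (fun k => by positivity) ((summable_nat_add_iff 1).2 (summable_pow_two_mul hn hR0 hR1))
    ?_ ?_ ?_
  · rintro ⟨α, β⟩ ⟨⟨h0, h1⟩, rfl⟩ ξ hξ
    refine mem_regularSet_of_gauge_ne ?_
    rw [dil_one]
    exact ((hsmall α h0 h1).trans_le hξ.1).ne'
  · intro k ξ hξ
    rw [M_eq hR0 η _ hξ, avgFamily, dil_one]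
  · intro k
    exact ⟨_, dil ((R ^ 2) ^ (k + 1)) η, fun h => lt_asymm h.1 (hsmall _ (by positivity) (hpow k)),
      fun ξ hξ => M_eq hR0 η _ hξ⟩

theorem imageSeries_U (hn : 1 ≤ n) (hR0 : 0 < R) (hR1 : R < 1) {η : Heis n}
    (hη : η ∈ annulus n R) : ImageSeries R (U R η) := by
  have hη0 := ne_zero_of_mem_closedAnnulus hR0 (annulus_subset_closedAnnulus n R hη)
  have hN := gauge_pos hη0
  have hR2 : R ^ 2 < 1 := pow_lt_one₀ hR0.le hR1 two_ne_zero
  have hpow : ∀ k : ℕ, (R ^ 2) ^ (k + 1) ≤ R ^ 2 := fun k => by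
    rw [pow_succ]; exact mul_le_of_le_one_left (by positivity) (pow_le_one₀ (by positivity) hR2.le)
  have hsmall : ∀ α, 0 ≤ α → α ≤ R ^ 2 → gauge (dil α (refl η)) < R := by
    intro α h0 h1
    rw [gauge_dil h0, gauge_refl hη0, ← div_eq_mul_inv, div_lt_iff₀ hN]
    nlinarith [hη.1]
  refine imageSeries_of_family (ζ := refl η) hR0 (K := Set.Icc 0 (R ^ 2) ×ˢ {1})
    (isCompact_Icc.prod isCompact_singleton) (p := fun k => ((R ^ 2) ^ (k + 1), 1))
    (fun k => ⟨⟨by positivity, hpow k⟩, rfl⟩)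
    (c := fun k => (R ^ (2 * n)) ^ (k + 1) * (gauge η ^ (2 * n))⁻¹)
    (fun k => by positivity)
    (((summable_nat_add_iff 1).2 (summable_pow_two_mul hn hR0 hR1)).mul_right _) ?_ ?_ ?_
  · rintro ⟨α, β⟩ ⟨⟨h0, h1⟩, rfl⟩ ξ hξ
    refine mem_regularSet_of_gauge_ne ?_
    rw [dil_one]
    exact ((hsmall α h0 h1).trans_le hξ.1).ne'
  · intro k ξ hξ
    rw [U_eq hR0 hη0 _ hξ, avgFamily, dil_one, _root_.mul_assoc]
  · intro k
    refine ⟨(R ^ (2 * n)) ^ (k + 1) * (gauge η ^ (2 * n))⁻¹, dil ((R ^ 2) ^ (k + 1)) (refl η),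
      fun h => lt_asymm h.1 (hsmall _ (by positivity) (hpow k)), fun ξ hξ => ?_⟩
    rw [U_eq hR0 hη0 _ hξ, _root_.mul_assoc]

theorem imageSeries_H (hn : 1 ≤ n) (hR0 : 0 < R) (hR1 : R < 1) {η : Heis n}
    (hη : η ∈ annulus n R) : ImageSeries R (H R η) := by
  have hη0 := ne_zero_of_mem_closedAnnulus hR0 (annulus_subset_closedAnnulus n R hη)
  have hN := gauge_pos hη0
  have hR2 : R ^ 2 < 1 := pow_lt_one₀ hR0.le hR1 two_ne_zero
  have hpow : ∀ k : ℕ, (R ^ 2) ^ k ≤ 1 := fun k => pow_le_one₀ (by positivity) hR2.le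
  have hinv : 1 < (gauge η)⁻¹ := (one_lt_inv₀ hN).2 hη.2
  -- The poles escape to infinity, so the dilation is kept on the argument, where its parameter
  -- stays bounded.
  refine imageSeries_of_family (ζ := refl η) hR0 (K := {1} ×ˢ Set.Icc 0 1)
    (isCompact_singleton.prod isCompact_Icc) (p := fun k => (1, (R ^ 2) ^ k))
    (fun k => ⟨rfl, ⟨by positivity, hpow k⟩⟩)
    (c := fun k => (R ^ (2 * n)) ^ k * (gauge η ^ (2 * n))⁻¹)
    (fun k => by positivity) ((summable_pow_two_mul hn hR0 hR1).mul_right _) ?_ ?_ ?_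
  · rintro ⟨α, β⟩ ⟨rfl, ⟨h0, h1⟩⟩ ξ hξ
    refine mem_regularSet_of_gauge_ne ?_
    rw [dil_one, gauge_refl hη0, gauge_dil h0]
    exact ((mul_le_one₀ h1 (gauge_nonneg ξ) hξ.2).trans_lt hinv).ne
  · intro k ξ hξ
    rw [H_eq hR0 hη0 _ hξ, avgFamily, dil_one, _root_.mul_assoc]
  · intro k
    have hs : 0 < (R ^ 2) ^ k := by positivity
    refine ⟨(R ^ (2 * n)) ^ k * ((gauge η ^ (2 * n))⁻¹ * (((R ^ 2) ^ k) ^ (2 * n))⁻¹),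
      dil ((R ^ 2) ^ k)⁻¹ (refl η), fun h => ?_, fun ξ hξ => ?_⟩
    · have := h.2
      rw [gauge_dil (by positivity), gauge_refl hη0] at this
      have h1 : 1 ≤ ((R ^ 2) ^ k)⁻¹ := (one_le_inv₀ hs).2 (hpow k)
      nlinarith
    · rw [H_eq hR0 hη0 _ hξ, avgSol_dil hs]
      ring

theorem imageSeries_V (hn : 1 ≤ n) (hR0 : 0 < R) (hR1 : R < 1) {η : Heis n}
    (hη : η ∈ annulus n R) : ImageSeries R (V R η) := by
  have hR2 : R ^ 2 < 1 := pow_lt_one₀ hR0.le hR1 two_ne_zero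
  have hpow : ∀ k : ℕ, (R ^ 2) ^ (k + 1) ≤ R ^ 2 := fun k => by
    rw [pow_succ]; exact mul_le_of_le_one_left (by positivity) (pow_le_one₀ (by positivity) hR2.le)
  -- Dilating the closed annulus by at most `R²` keeps it strictly inside the sphere through `η`, so
  -- the kernel stays regular.
  have hRR : R ^ 2 < gauge η := by nlinarith [hη.1]
  refine imageSeries_of_family (ζ := η) hR0 (K := {1} ×ˢ Set.Icc 0 (R ^ 2))
    (isCompact_singleton.prod isCompact_Icc) (p := fun k => (1, (R ^ 2) ^ (k + 1)))
    (fun k => ⟨rfl, ⟨by positivity, hpow k⟩⟩)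
    (c := fun k => (R ^ (2 * n)) ^ (k + 1))
    (fun k => by positivity) ((summable_nat_add_iff 1).2 (summable_pow_two_mul hn hR0 hR1)) ?_ ?_ ?_
  · rintro ⟨α, β⟩ ⟨rfl, ⟨h0, h1⟩⟩ ξ hξ
    refine mem_regularSet_of_gauge_ne ?_
    rw [dil_one, gauge_dil h0]
    exact ((mul_le_of_le_one_right h0 hξ.2).trans_lt (h1.trans_lt hRR)).ne
  · intro k ξ hξ
    rw [V_eq hR0 η _ hξ, avgFamily, dil_one]
  · intro k
    have hs : 0 < (R ^ 2) ^ (k + 1) := by positivity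
    refine ⟨(R ^ (2 * n)) ^ (k + 1) * (((R ^ 2) ^ (k + 1)) ^ (2 * n))⁻¹,
      dil ((R ^ 2) ^ (k + 1))⁻¹ η, fun h => ?_, fun ξ hξ => ?_⟩
    · have := h.2
      rw [gauge_dil (by positivity), inv_mul_lt_iff₀ hs] at this
      linarith [hpow k]
    · rw [V_eq hR0 η _ hξ, avgSol_dil hs]
      ring

theorem contDiffAt_avgSol {η ξ : Heis n} (h : ξ ∉ orbit η) : ContDiffAt ℝ ∞ (avgSol η) ξ := by
  have h1 := (contDiffOn_avgFamily η).contDiffAt ((isOpen_regularSet η).mem_nhds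
    (mem_regularSet_of_notMem_orbit h))
  have h2 : ContDiffAt ℝ ∞ (fun x : Heis n => (((1 : ℝ), (1 : ℝ)), x)) ξ :=
    contDiffAt_const.prodMk contDiffAt_id
  have h3 : avgSol η = avgFamily η ∘ fun x : Heis n => (((1 : ℝ), (1 : ℝ)), x) := by
    ext x
    simp [avgFamily]
  rw [h3]
  exact h1.comp ξ h2

/-! ### The Green function as a perturbation of the fundamental solution -/

/-- The smooth part of the Green function: all terms except the averaged fundamental solution. -/
def greenRest (R : ℝ) (η ξ : Heis n) : ℝ :=
  ((∑' k, M R η (k + 1) ξ) - ∑' k, H R η k ξ) + ((∑' k, V R η k ξ) - ∑' k, U R η k ξ)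

section Green

variable (hn : 1 ≤ n) (hR0 : 0 < R) (hR1 : R < 1) {η : Heis n} (hη : η ∈ annulus n R)
include hn hR0 hR1 hη

theorem G_eq {ξ : Heis n} (hξ : ξ ∈ closedAnnulus n R) :
    G R η ξ = avgSol η ξ + greenRest R η ξ := by
  have hM := (imageSeries_M hn hR0 hR1 hη).hasMajorants.summable hξ
  have hM' : Summable fun k => M R η k ξ := (summable_nat_add_iff 1).1 hM
  have hH := (imageSeries_H hn hR0 hR1 hη).hasMajorants.summable hξ
  have hU := (imageSeries_U hn hR0 hR1 hη).hasMajorants.summable hξ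
  have hV := (imageSeries_V hn hR0 hR1 hη).hasMajorants.summable hξ
  rw [G, hM'.tsum_sub hH, hV.tsum_sub hU, hM'.tsum_eq_zero_add, greenRest]
  simp only [M, avgSol]
  ring

theorem contDiffAt_greenRest {ξ : Heis n} (hξ : ξ ∈ closedAnnulus n R) :
    ContDiffAt ℝ ∞ (greenRest R η) ξ :=
  (((imageSeries_M hn hR0 hR1 hη).contDiffAt ξ hξ).sub
    ((imageSeries_H hn hR0 hR1 hη).contDiffAt ξ hξ)).add
  (((imageSeries_V hn hR0 hR1 hη).contDiffAt ξ hξ).sub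
    ((imageSeries_U hn hR0 hR1 hη).contDiffAt ξ hξ))

theorem green_eq_zero_of_gauge_eq_one {ξ : Heis n} (hξ : gauge ξ = 1) :
    avgSol η ξ + greenRest R η ξ = 0 := by
  have hA : ξ ∈ closedAnnulus n R := ⟨by rw [hξ]; exact hR1.le, hξ.le⟩
  have hη0 := ne_zero_of_mem_closedAnnulus hR0 (annulus_subset_closedAnnulus n R hη)
  rw [← G_eq hn hR0 hR1 hη hA, G]
  simp [H_eq_M hR0 hη0 _ hξ, U_eq_V hR0 hη0 _ hξ]

/-- Splitting off the zeroth term of `U`, which cancels `avgSol η`, aligns the shifted series; what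
remains cancels term by term. -/
theorem green_eq_zero_of_gauge_eq {ξ : Heis n} (hξ : gauge ξ = R) :
    avgSol η ξ + greenRest R η ξ = 0 := by
  have hA : ξ ∈ closedAnnulus n R := ⟨hξ.ge, by rw [hξ]; exact hR1.le⟩
  have hη0 := ne_zero_of_mem_closedAnnulus hR0 (annulus_subset_closedAnnulus n R hη)
  have hU := (imageSeries_U hn hR0 hR1 hη).hasMajorants.summable hA
  rw [greenRest, hU.tsum_eq_zero_add]
  simp only [H_eq_M_succ hR0 hη0 _ hξ, U_succ_eq_V hR0 hη0 _ hξ, U_zero_eq_M hR0 hη0 hξ]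
  simp [M]

end Green

/-! ### Properness of the gauge and limits at spheres -/

theorem norm_le_of_gauge_le {r : ℝ} (hr : 1 ≤ r) {ξ : Heis n} (h : gauge ξ ≤ r) : ‖ξ‖ ≤ r ^ 2 := by
  have h4 : quartic ξ ≤ r ^ 4 := by
    rw [← gauge_pow_four]; exact pow_le_pow_left₀ (gauge_nonneg ξ) h 4
  unfold quartic at h4
  have hz := normSq_nonneg ξ.1
  have hz2 : normSq ξ.1 ≤ r ^ 2 := by
    refine (pow_le_pow_iff_left₀ hz (by positivity) two_ne_zero).1 ?_
    nlinarith [sq_nonneg ξ.2]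
  rw [norm_prod_le_iff]
  constructor
  · rw [pi_norm_le_iff_of_nonneg (by positivity)]
    intro j
    have h1 : ‖ξ.1 j‖ ^ 2 ≤ normSq ξ.1 :=
      Finset.single_le_sum (f := fun j => ‖ξ.1 j‖ ^ 2) (fun _ _ => by positivity) (Finset.mem_univ j)
    have h2 : ‖ξ.1 j‖ ≤ r := abs_le_of_sq_le_sq' (h1.trans hz2) (by linarith) |>.2
    nlinarith
  · rw [Real.norm_eq_abs]
    apply abs_le_of_sq_le_sq _ (by positivity)
    nlinarith [sq_nonneg (normSq ξ.1)]

theorem isClosedMap_gauge : IsClosedMap (gauge : Heis n → ℝ) := by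
  refine IsProperMap.isClosedMap (isProperMap_iff_isCompact_preimage.2
    ⟨continuous_gauge, fun K hK => ?_⟩)
  obtain ⟨B, hB⟩ := hK.isBounded.subset_closedBall 0
  refine (isCompact_closedBall (0 : Heis n) ((max B 1) ^ 2)).of_isClosed_subset
    (hK.isClosed.preimage continuous_gauge) fun ξ hξ => ?_
  rw [Metric.mem_closedBall, dist_zero_right]
  have h := hB hξ
  rw [Metric.mem_closedBall, dist_zero_right] at h
  exact norm_le_of_gauge_le (le_max_right _ _) ((le_abs_self _).trans (h.trans (le_max_left _ _)))

/-- For a closed map, every neighbourhood of a fibre contains the preimage of a neighbourhood of the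
point. Pointwise continuity and vanishing on the sphere therefore give a limit uniform along it. -/
theorem tendsto_comap_gauge {F : Heis n → ℝ} {r : ℝ}
    (hF : ∀ ξ, gauge ξ = r → ContinuousAt F ξ) (h0 : ∀ ξ, gauge ξ = r → F ξ = 0) :
    Tendsto F (comap gauge (𝓝 r)) (𝓝 0) := by
  have h : Tendsto F (𝓝ˢ (gauge ⁻¹' {r})) (𝓝 0) := by
    intro s hs
    rw [mem_map, mem_nhdsSet_iff_forall]
    intro ξ hξ
    have := (hF ξ hξ).tendsto
    rw [h0 ξ hξ] at this
    exact this hs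
  exact h.mono_left (isClosedMap_gauge.comap_nhds_le)

/-! ### Distributional action of the series -/

/-- Each term integrates to zero because its pole avoids the rotation-invariant annulus containing
the support; the majorants on that compact support justify summing the integrals. -/
theorem ImageSeries.integral_tsum_smul_L0 (hn : 1 ≤ n) (hR0 : 0 < R) {F : ℕ → Heis n → ℝ}
    (hF : ImageSeries R F) {f : Heis n → ℂ} (hf : ContDiff ℝ ∞ f) (hc : HasCompactSupport f)
    (hs : tsupport f ⊆ annulus n R) :
    Integrable (fun ξ => (∑' k, F k ξ) • L0 f ξ) ∧ ∫ ξ, (∑' k, F k ξ) • L0 f ξ = 0 := by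
  have hsA := hs.trans (annulus_subset_closedAnnulus n R)
  have hL := continuous_L0 hf
  have hLc := hasCompactSupport_L0 hf hc
  have hzero : ∀ ξ ∉ tsupport f, L0 f ξ = 0 := fun ξ h => L0_eq_zero_of_notMem_tsupport hf h
  have hterm : ∀ k, Integrable (fun ξ => F k ξ • L0 f ξ) ∧ ∫ ξ, F k ξ • L0 f ξ = 0 := by
    intro k
    obtain ⟨c, ζ, hζ, h⟩ := hF.pole k
    have heq : (fun ξ => F k ξ • L0 f ξ) = fun ξ => c • (avgSol ζ ξ • L0 f ξ) := by
      ext ξ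
      by_cases hξ : ξ ∈ tsupport f
      · rw [h ξ (ne_zero_of_mem_closedAnnulus hR0 (hsA hξ)), mul_smul]
      · simp [hzero ξ hξ]
    rw [heq, integral_smul, integral_avgSol_smul_L0_eq_zero hn ζ hζ hf hc hs, smul_zero]
    exact ⟨(integrable_avgSol_smul hn ζ hL hLc).smul c, rfl⟩
  obtain ⟨b, hb, hbound⟩ := hF.hasMajorants (tsupport f) hsA hc.isCompact
  have hsum : Summable fun k => ∫ ξ, ‖F k ξ • L0 f ξ‖ := by
    refine Summable.of_nonneg_of_le (fun k => integral_nonneg fun _ => norm_nonneg _) (fun k => ?_)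
      (hb.mul_right (∫ ξ, ‖L0 f ξ‖))
    rw [← integral_const_mul]
    refine integral_mono (hterm k).1.norm
      ((hL.integrable_of_hasCompactSupport hLc).norm.const_mul _) fun ξ => ?_
    simp only [norm_smul, Real.norm_eq_abs]
    by_cases hξ : ξ ∈ tsupport f
    · exact mul_le_mul_of_nonneg_right (hbound k ξ hξ) (norm_nonneg _)
    · simp [hzero ξ hξ]
  have h := hasSum_integral_of_summable_integral_norm (fun k => (hterm k).1) hsum
  have heq : ∀ ξ, ∑' k, F k ξ • L0 f ξ = (∑' k, F k ξ) • L0 f ξ := by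
    intro ξ
    by_cases hξ : ξ ∈ tsupport f
    · exact (hF.hasMajorants.summable (hsA hξ)).tsum_smul_const _
    · simp [hzero ξ hξ]
  simp only [heq, (hterm _).2] at h
  refine ⟨?_, h.unique hasSum_zero⟩
  have hcont : ContinuousOn (fun ξ => (∑' k, F k ξ) • L0 f ξ) (tsupport f) :=
    ContinuousOn.smul (fun ξ hξ => (hF.contDiffAt ξ (hsA hξ)).continuousAt.continuousWithinAt)
      hL.continuousOn
  refine (integrableOn_iff_integrable_of_support_subset fun ξ hξ => ?_).1
    (hcont.integrableOn_compact hc.isCompact)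
  by_contra h'
  simp [hzero ξ h'] at hξ

section Green

variable (hn : 1 ≤ n) (hR0 : 0 < R) (hR1 : R < 1) {η : Heis n} (hη : η ∈ annulus n R)
include hn hR0 hR1 hη

theorem integral_G_mul_L0 {f : Heis n → ℂ} (hf : ContDiff ℝ ∞ f) (hc : HasCompactSupport f)
    (hs : tsupport f ⊆ annulus n R) : ∫ ξ, (G R η ξ : ℂ) * L0 f ξ = circAvg f η := by
  have hM := (imageSeries_M hn hR0 hR1 hη).integral_tsum_smul_L0 hn hR0 hf hc hs
  have hH := (imageSeries_H hn hR0 hR1 hη).integral_tsum_smul_L0 hn hR0 hf hc hs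
  have hU := (imageSeries_U hn hR0 hR1 hη).integral_tsum_smul_L0 hn hR0 hf hc hs
  have hV := (imageSeries_V hn hR0 hR1 hη).integral_tsum_smul_L0 hn hR0 hf hc hs
  have hA := integrable_avgSol_smul hn η (continuous_L0 hf) (hasCompactSupport_L0 hf hc)
  have heq : ∀ ξ, (G R η ξ : ℂ) * L0 f ξ = avgSol η ξ • L0 f ξ +
      (((∑' k, M R η (k + 1) ξ) • L0 f ξ - (∑' k, H R η k ξ) • L0 f ξ) +
        ((∑' k, V R η k ξ) • L0 f ξ - (∑' k, U R η k ξ) • L0 f ξ)) := by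
    intro ξ
    by_cases hξ : ξ ∈ tsupport f
    · rw [G_eq hn hR0 hR1 hη (annulus_subset_closedAnnulus n R (hs hξ)), ← Complex.real_smul,
        greenRest, add_smul, add_smul, sub_smul, sub_smul]
    · simp [L0_eq_zero_of_notMem_tsupport hf hξ]
  simp only [heq]
  have h1 : Integrable fun ξ =>
      (∑' k, M R η (k + 1) ξ) • L0 f ξ - (∑' k, H R η k ξ) • L0 f ξ := hM.1.sub hH.1
  have h2 : Integrable fun ξ =>
      (∑' k, V R η k ξ) • L0 f ξ - (∑' k, U R η k ξ) • L0 f ξ := hV.1.sub hU.1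
  have h3 : Integrable fun ξ =>
      ((∑' k, M R η (k + 1) ξ) • L0 f ξ - (∑' k, H R η k ξ) • L0 f ξ) +
        ((∑' k, V R η k ξ) • L0 f ξ - (∑' k, U R η k ξ) • L0 f ξ) := h1.add h2
  rw [integral_add hA h3, integral_add h1 h2, integral_sub hM.1 hH.1, integral_sub hV.1 hU.1,
    hM.2, hH.2, hU.2, hV.2, integral_avgSol_smul_L0 hn η hf hc]
  simp

/-! ### Regularity, convergence and boundary behaviour of the Green function -/

theorem locallyIntegrableOn_G : LocallyIntegrableOn (G R η) (annulus n R) := by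
  rw [locallyIntegrableOn_iff (isOpen_annulus n R).isLocallyClosed]
  intro K hK hc
  have h : IntegrableOn (fun ξ => avgSol η ξ + greenRest R η ξ) K := by
    have hcont : ContinuousOn (greenRest R η) K := fun ξ hξ =>
      (contDiffAt_greenRest hn hR0 hR1 hη
        (annulus_subset_closedAnnulus n R (hK hξ))).continuousAt.continuousWithinAt
    exact (integrableOn_avgSol hn η hc).add (hcont.integrableOn_compact hc)
  exact h.congr_fun (fun ξ hξ => (G_eq hn hR0 hR1 hη
    (annulus_subset_closedAnnulus n R (hK hξ))).symm) hc.measurableSet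

theorem contDiffOn_G : ContDiffOn ℝ ∞ (G R η) (annulus n R \ orbit η) := by
  have h : ContDiffOn ℝ ∞ (fun ξ => avgSol η ξ + greenRest R η ξ) (annulus n R \ orbit η) :=
    fun ξ hξ => ((contDiffAt_avgSol hξ.2).add (contDiffAt_greenRest hn hR0 hR1 hη
      (annulus_subset_closedAnnulus n R hξ.1))).contDiffWithinAt
  exact h.congr fun ξ hξ => G_eq hn hR0 hR1 hη (annulus_subset_closedAnnulus n R hξ.1)

theorem hasMajorants_M_sub_H :
    HasMajorants (fun k ξ => M R η k ξ - H R η k ξ) (annulus n R \ orbit η) := by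
  have hsub : annulus n R \ orbit η ⊆ closedAnnulus n R :=
    Set.sdiff_subset.trans (annulus_subset_closedAnnulus n R)
  refine HasMajorants.sub (HasMajorants.of_succ (fun ξ hξ => ?_)
    ((imageSeries_M hn hR0 hR1 hη).hasMajorants.mono hsub))
    ((imageSeries_H hn hR0 hR1 hη).hasMajorants.mono hsub)
  exact (contDiffAt_avgSol hξ.2).continuousAt.continuousWithinAt

theorem hasMajorants_V_sub_U :
    HasMajorants (fun k ξ => V R η k ξ - U R η k ξ) (annulus n R \ orbit η) :=
  ((imageSeries_V hn hR0 hR1 hη).hasMajorants.sub (imageSeries_U hn hR0 hR1 hη).hasMajorants).mono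
    (Set.sdiff_subset.trans (annulus_subset_closedAnnulus n R))

theorem tendsto_green_comap {r : ℝ} (hr : R ≤ r ∧ r ≤ 1) (hne : r ≠ gauge η)
    (h0 : ∀ ξ, gauge ξ = r → avgSol η ξ + greenRest R η ξ = 0) :
    Tendsto (fun ξ => avgSol η ξ + greenRest R η ξ) (comap gauge (𝓝 r)) (𝓝 0) := by
  refine tendsto_comap_gauge (fun ξ hξ => ?_) h0
  refine (contDiffAt_avgSol fun h => hne ?_).continuousAt.add
    (contDiffAt_greenRest hn hR0 hR1 hη (by rw [← hξ] at hr; exact hr)).continuousAt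
  rw [← hξ, gauge_eq_of_mem_orbit h]

theorem tendsto_G_one : Tendsto (G R η) (comap gauge (𝓝[<] 1)) (𝓝 0) := by
  have h := tendsto_green_comap hn hR0 hR1 hη ⟨hR1.le, le_rfl⟩ hη.2.ne'
    fun ξ => green_eq_zero_of_gauge_eq_one hn hR0 hR1 hη
  refine (h.mono_left (comap_mono nhdsWithin_le_nhds)).congr' ?_
  -- The decomposition of `G` is available only on the closed annulus, so the one-sided filter is
  -- restricted to gauges between `R` and `1`.
  have hm : Set.Ioo R 1 ∈ 𝓝[<] (1 : ℝ) := Ioo_mem_nhdsLT hR1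
  filter_upwards [preimage_mem_comap hm] with ξ hξ
  exact (G_eq hn hR0 hR1 hη ⟨hξ.1.le, hξ.2.le⟩).symm

theorem tendsto_G_inner : Tendsto (G R η) (comap gauge (𝓝[>] R)) (𝓝 0) := by
  have h := tendsto_green_comap hn hR0 hR1 hη ⟨le_rfl, hR1.le⟩ hη.1.ne
    fun ξ => green_eq_zero_of_gauge_eq hn hR0 hR1 hη
  refine (h.mono_left (comap_mono nhdsWithin_le_nhds)).congr' ?_
  have hm : Set.Ioo R 1 ∈ 𝓝[>] R := Ioo_mem_nhdsGT hR1
  filter_upwards [preimage_mem_comap hm] with ξ hξ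
  exact (G_eq hn hR0 hR1 hη ⟨hξ.1.le, hξ.2.le⟩).symm

end Green

end Heisenberg
end

/-! ### The main theorem -/

theorem theorem2p1 (n : ℕ) (hn : 1 ≤ n) (R : ℝ) (hR0 : 0 < R) (hR1 : R < 1)
    (η : Heisenberg.Heis n) (hη : η ∈ Heisenberg.annulus n R) :
    -- both series converge absolutely and locally uniformly on `D` off the circle through `η`
    (SummableLocallyUniformlyOn
        (fun k ξ => |Heisenberg.M R η k ξ - Heisenberg.H R η k ξ|)
        (Heisenberg.annulus n R \ Heisenberg.orbit η) ∧
      SummableLocallyUniformlyOn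
        (fun k ξ => |Heisenberg.V R η k ξ - Heisenberg.U R η k ξ|)
        (Heisenberg.annulus n R \ Heisenberg.orbit η) ∧
      HasSumLocallyUniformlyOn
        (fun k ξ => Heisenberg.M R η k ξ - Heisenberg.H R η k ξ)
        (fun ξ => ∑' k, (Heisenberg.M R η k ξ - Heisenberg.H R η k ξ))
        (Heisenberg.annulus n R \ Heisenberg.orbit η) ∧
      HasSumLocallyUniformlyOn
        (fun k ξ => Heisenberg.V R η k ξ - Heisenberg.U R η k ξ)
        (fun ξ => ∑' k, (Heisenberg.V R η k ξ - Heisenberg.U R η k ξ))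
        (Heisenberg.annulus n R \ Heisenberg.orbit η)) ∧
    -- smoothness
    ContDiffOn ℝ ∞ (Heisenberg.G R η) (Heisenberg.annulus n R \ Heisenberg.orbit η) ∧
    -- `L₀ G(η, ·) = δ_η` in the sense of distributions on `D`, for circular test functions;
    -- on a general test function the distribution gives the circular average at `η`
    MeasureTheory.LocallyIntegrableOn (Heisenberg.G R η) (Heisenberg.annulus n R) ∧
    (∀ φ : Heisenberg.Heis n → ℂ, ContDiff ℝ ∞ φ → HasCompactSupport φ →
      tsupport φ ⊆ Heisenberg.annulus n R → Heisenberg.IsCircular φ →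
        ∫ ξ, (Heisenberg.G R η ξ : ℂ) * Heisenberg.L0 φ ξ = φ η) ∧
    (∀ φ : Heisenberg.Heis n → ℂ, ContDiff ℝ ∞ φ → HasCompactSupport φ →
      tsupport φ ⊆ Heisenberg.annulus n R →
        ∫ ξ, (Heisenberg.G R η ξ : ℂ) * Heisenberg.L0 φ ξ = Heisenberg.circAvg φ η) ∧
    -- boundary limits as `N(ξ) → 1` and `N(ξ) → R` within `D`
    Filter.Tendsto (Heisenberg.G R η)
      (Filter.comap Heisenberg.gauge (nhdsWithin 1 (Set.Iio 1))) (nhds 0) ∧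
    Filter.Tendsto (Heisenberg.G R η)
      (Filter.comap Heisenberg.gauge (nhdsWithin R (Set.Ioi R))) (nhds 0) := by
  have hopen : IsOpen (Heisenberg.annulus n R \ Heisenberg.orbit η) :=
    (Heisenberg.isOpen_annulus n R).sdiff (Heisenberg.isClosed_orbit η)
  have hMH := Heisenberg.hasMajorants_M_sub_H hn hR0 hR1 hη
  have hVU := Heisenberg.hasMajorants_V_sub_U hn hR0 hR1 hη
  refine ⟨⟨hMH.summableLocallyUniformlyOn_abs hopen, hVU.summableLocallyUniformlyOn_abs hopen,
    hMH.hasSumLocallyUniformlyOn hopen, hVU.hasSumLocallyUniformlyOn hopen⟩,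
    Heisenberg.contDiffOn_G hn hR0 hR1 hη, Heisenberg.locallyIntegrableOn_G hn hR0 hR1 hη,
    fun φ hφ hc hs hcirc => ?_, fun φ hφ hc hs => Heisenberg.integral_G_mul_L0 hn hR0 hR1 hη hφ hc hs,
    Heisenberg.tendsto_G_one hn hR0 hR1 hη, Heisenberg.tendsto_G_inner hn hR0 hR1 hη⟩
  rw [Heisenberg.integral_G_mul_L0 hn hR0 hR1 hη hφ hc hs,
    Heisenberg.circAvg_of_isCircular hcirc]
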